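/- Let $\overline{\mathbb R}=\mathbb R\cup\{\infty\}$ be the one-point compactification of $\mathbb R$ (a topological circle), and identify both $-\infty$ and $+\infty$ with $\infty$. **Operators.** For $V\colon\mathbb Z^d\to\overline{\mathbb R}$ let $I(V)=\{\mathbf n: V(\mathbf n)=\infty\}$, and let $H=\Delta+V$ be the self-adjoint operator in $\ell^2(\mathbb Z^d\setminus I(V))$ with domain $\{\psi: V\psi\in\ell^2\}$ given by $$(H\psi)(\mathbf n)=\sum_{|\mathbf m-\mathbf n|_1=1}\psi(\mathbf m)+V(\mathbf n)\psi(\mathbf n),\qquad \mathbf n\in\mathbb Z^d\setminus I(V),$$ where $\psi$ is extended by $0$ to $I(V)$. Its generalized spectrum $\bar\sigma(H)\subset\overline{\mathbb R}$ is the closure of $\sigma(H)$ in $\overline{\mathbb R}$ if $I(V)=\varnothing$, and $\sigma(H)\cup\{\infty\}$ otherwise. **Simple discontinuity.** A $1$-periodic function $f\colon\mathbb R\to[-\infty,+\infty)$ has a simple discontinuity if $f|_{[0,1)}$ extends to a continuous map $[0,1]\to[-\infty,+\infty]$, $f(0)\ne f(1-0)$, and at least one of $f(0)$, $f(1-0)$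 is finite. **Theorem.** Let $f$ have a simple discontinuity and let $\alpha\in\mathbb R^d$ have at least one irrational component. Let $\mathcal A\subset\overline{\mathbb R}$ be a closed arc with endpoints $f(0)$ and $f(1-0)$, with continuous injective parametrization $\varphi\colon[-1,0]\to\mathcal A$, $\varphi(-1)=f(1-0)$, $\varphi(0)=f(0)$. Let $\tilde f$ be equal to $f$ on $[0,1)$ and to $\varphi$ on $[-1,0)$; identifying $[-1,1)$ with the circle $\mathbb R/2\mathbb Z$, $\tilde f$ is a continuous map from this circle to the circle $\overline{\mathbb R}$. Suppose that $\tilde f$ is not homotopic to a constant map. For $t\in\mathcal A$ let $f_t$ be the $1$-periodic function that equals $f$ on $(0,1)$ and $t$ at $0$, and let $H_t(0)=\Delta+V_t$ be the operator on $\mathbb Z^d$ with potential $V_t(\mathbf n)=f_t(\mathbf n\cdot\alpha)$. Then $$\bigcup_{t\in\mathcal A}\bar\sigma(H_t(0))=\overline{\mathbb R}.$$ -/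

import Mathlib

open Set Filter Topology

noncomputable section

namespace GapFilling

/-! ### The extended line and circle maps

The extended line `ℝ ∪ {∞}` is `OnePoint ℝ`, which is a topological circle. -/

/-- The identification of `[-∞, +∞]` with the extended line, in which both `-∞` and `+∞` become
the point `∞`. Restricted to `[-∞, +∞)` it is a bijection. -/
def toRbar (x : EReal) : OnePoint ℝ :=
  if x = ⊤ ∨ x = ⊥ then OnePoint.infty else ((x.toReal : ℝ) : OnePoint ℝ)

/-- A `1`-periodic `f : ℝ → [-∞, +∞)` has a simple discontinuity if its restriction to `[0, 1)`
extends to a continuous map `[0, 1] → [-∞, +∞]`, `f(0) ≠ f(1 - 0)`, and at least one of `f(0)`,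
`f(1 - 0)` is finite. -/
structure HasSimpleDiscontinuity (f : ℝ → EReal) : Prop where
  periodic : Function.Periodic f 1
  ne_top : ∀ x, f x ≠ ⊤
  extends_continuously : ∃ g : ℝ → EReal, ContinuousOn g (Icc 0 1) ∧ EqOn g f (Ico 0 1)
  jump : f 0 ≠ Function.leftLim f 1
  finite : (f 0 ≠ ⊥ ∧ f 0 ≠ ⊤) ∨ (Function.leftLim f 1 ≠ ⊥ ∧ Function.leftLim f 1 ≠ ⊤)

/-- `φ : [-1, 0] → 𝒜` is a continuous (injective) parametrization of the closed arc `𝒜` of the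
extended line, running from `φ (-1) = a` to `φ 0 = b`. -/
structure IsArcParam (φ : ℝ → OnePoint ℝ) (𝒜 : Set (OnePoint ℝ)) (a b : OnePoint ℝ) : Prop where
  continuousOn : ContinuousOn φ (Icc (-1) 0)
  injOn : InjOn φ (Icc (-1) 0)
  image_eq : φ '' Icc (-1) 0 = 𝒜
  left_eq : φ (-1) = a
  right_eq : φ 0 = b

/-- The map `f̃` on `[-1, 1)`: it is `f` on `[0, 1)` and `φ` on `[-1, 0)`. -/
def glued (f : ℝ → EReal) (φ : ℝ → OnePoint ℝ) (y : ℝ) : OnePoint ℝ :=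
  if 0 ≤ y then toRbar (f y) else φ y

instance fact_zero_lt_two_real : Fact ((0 : ℝ) < 2) := ⟨two_pos⟩

theorem continuous_toRbar : Continuous toRbar := by
  have h0 : ∀ r : ℝ, toRbar (r : EReal) = (r : OnePoint ℝ) := fun r => by simp [toRbar]
  have key : ∀ s : Set (OnePoint ℝ), s ∈ 𝓝 (OnePoint.infty : OnePoint ℝ) →
      OnePoint.infty ∈ s ∧ (∃ R : ℝ, ∀ r : ℝ, R < r → (r : OnePoint ℝ) ∈ s) ∧
        ∃ R : ℝ, ∀ r : ℝ, r < R → (r : OnePoint ℝ) ∈ s := by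
    intro s hs
    have h1 : (fun r : ℝ => (r : OnePoint ℝ)) ⁻¹' s ∈ coclosedCompact ℝ := by
      rw [← OnePoint.comap_coe_nhds_infty]
      exact preimage_mem_comap hs
    rw [coclosedCompact_eq_cocompact, cocompact_eq_atBot_atTop] at h1
    obtain ⟨h2, h3⟩ := mem_sup.1 h1
    obtain ⟨R, hR⟩ := mem_atBot_sets.1 h2
    obtain ⟨R', hR'⟩ := mem_atTop_sets.1 h3
    exact ⟨mem_of_mem_nhds hs, ⟨R', fun r hr => hR' r hr.le⟩, ⟨R, fun r hr => hR r hr.le⟩⟩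
  rw [continuous_iff_continuousAt]
  intro x
  induction x with
  | bot =>
    intro s hs
    have hb : toRbar ⊥ = OnePoint.infty := by simp [toRbar]
    rw [hb] at hs
    obtain ⟨hi, -, R, hR⟩ := key s hs
    refine EReal.mem_nhds_bot_iff.2 ⟨R, fun y hy => ?_⟩
    induction y with
    | bot => simpa [toRbar] using hi
    | coe r => simpa [h0] using hR r (by simpa using hy)
    | top => simpa [toRbar] using hi
  | coe r =>
    have h1 : toRbar ∘ ((↑) : ℝ → EReal) = fun r : ℝ => (r : OnePoint ℝ) := funext h0
    rw [← EReal.isOpenEmbedding_coe.continuousAt_iff, h1]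
    exact OnePoint.continuous_coe.continuousAt
  | top =>
    intro s hs
    have hb : toRbar ⊤ = OnePoint.infty := by simp [toRbar]
    rw [hb] at hs
    obtain ⟨hi, ⟨R, hR⟩, -⟩ := key s hs
    refine EReal.mem_nhds_top_iff.2 ⟨R, fun y hy => ?_⟩
    induction y with
    | bot => simpa [toRbar] using hi
    | coe r => simpa [h0] using hR r (by simpa using hy)
    | top => simpa [toRbar] using hi

theorem continuous_glued {f : ℝ → EReal} (hf : HasSimpleDiscontinuity f)
    {φ : ℝ → OnePoint ℝ} {𝒜 : Set (OnePoint ℝ)}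
    (hφ : IsArcParam φ 𝒜 (toRbar (Function.leftLim f 1)) (toRbar (f 0))) :
    Continuous (AddCircle.liftIco (2 : ℝ) (-1) (glued f φ)) := by
  obtain ⟨g, hg, hgf⟩ := hf.extends_continuously
  have hg1 : Function.leftLim f 1 = g 1 := by
    apply leftLim_eq_of_tendsto
    have h1 : Tendsto g (𝓝[Ico 0 1] 1) (𝓝 (g 1)) :=
      (hg 1 (by simp)).mono_left (nhdsWithin_mono _ Ico_subset_Icc_self)
    rw [← nhdsWithin_Ico_eq_nhdsLT (zero_lt_one (α := ℝ))]
    exact h1.congr' (eventually_nhdsWithin_of_forall fun y hy => hgf hy)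
  have hg0 : g 0 = f 0 := hgf (by simp)
  have heq : AddCircle.liftIco (2 : ℝ) (-1) (glued f φ)
      = AddCircle.liftIco (2 : ℝ) (-1) (fun y => if y ≤ 0 then φ y else toRbar (g y)) := by
    funext x
    obtain ⟨y, hy, rfl⟩ : ∃ y ∈ Ico (-1 : ℝ) (-1 + 2), (y : AddCircle (2 : ℝ)) = x :=
      ⟨_, (AddCircle.equivIco 2 (-1) x).2, AddCircle.coe_equivIco⟩
    rw [AddCircle.liftIco_coe_apply hy, AddCircle.liftIco_coe_apply hy]
    have hy2 : y < 1 := by linarith [hy.2]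
    rcases lt_trichotomy y 0 with h | h | h
    · simp [glued, h.le, not_le.2 h]
    · simp [glued, h, hφ.right_eq]
    · simp [glued, h.le, not_le.2 h, hgf ⟨h.le, hy2⟩]
  rw [heq]
  apply AddCircle.liftIco_continuous
  · norm_num [hφ.left_eq, hg1]
  · have hI : Icc (-1 : ℝ) (-1 + 2) = Icc (-1) 0 ∪ Icc 0 1 := by
      rw [Icc_union_Icc_eq_Icc (by norm_num) (by norm_num)]; norm_num
    rw [hI]
    apply ContinuousOn.union_of_isClosed _ _ isClosed_Icc isClosed_Icc
    · exact hφ.continuousOn.congr fun y hy => by simp [hy.2]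
    · refine (continuous_toRbar.comp_continuousOn hg).congr fun y hy => ?_
      rcases hy.1.eq_or_lt with h | h
      · simp [← h, hφ.right_eq, hg0]
      · simp [not_le.2 h]

/-- The circle map associated to `f̃`: the circle obtained from `[-1, 1)` is `ℝ / 2ℤ`. -/
def gluedCircleMap {f : ℝ → EReal} (hf : HasSimpleDiscontinuity f)
    {φ : ℝ → OnePoint ℝ} {𝒜 : Set (OnePoint ℝ)}
    (hφ : IsArcParam φ 𝒜 (toRbar (Function.leftLim f 1)) (toRbar (f 0))) :
    C(AddCircle (2 : ℝ), OnePoint ℝ) where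
  toFun := AddCircle.liftIco (2 : ℝ) (-1) (glued f φ)
  continuous_toFun := continuous_glued hf hφ

/-- The `1`-periodic function `f_t`: equal to `f` on `(0, 1)` and to `t` at `0`. -/
def replaceAtZero (f : ℝ → EReal) (t : OnePoint ℝ) (x : ℝ) : OnePoint ℝ :=
  if Int.fract x = 0 then t else toRbar (f x)

/-! ### Spectrum of an unbounded operator -/

/-- `z` is in the resolvent set of `A` if `A - z : dom A → E` is a bijection with a bounded
everywhere defined inverse `R`. -/
def resolventSet {E : Type*} [NormedAddCommGroup E] [NormedSpace ℂ E] (A : E →ₗ.[ℂ] E) : Set ℂ :=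
  {z | ∃ R : E →L[ℂ] E,
    (∀ y : E, ∃ x : A.domain, (x : E) = R y ∧ A x - z • (x : E) = y) ∧
    ∀ x : A.domain, R (A x - z • (x : E)) = x}

/-- The spectrum of `A`. -/
def spectrumPMap {E : Type*} [NormedAddCommGroup E] [NormedSpace ℂ E] (A : E →ₗ.[ℂ] E) : Set ℂ :=
  (resolventSet A)ᶜ

/-! ### Schrödinger operators with potentials in the extended line -/

variable {d : ℕ}

/-- The discrete Laplacian on `ℤ^d`: the sum over the `2d` nearest neighbours. -/
def lap (ψ : (Fin d → ℤ) → ℂ) (n : Fin d → ℤ) : ℂ :=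
  ∑ i : Fin d, (ψ (n + Pi.single i 1) + ψ (n - Pi.single i 1))

/-- The set `I(V)` of sites at which the potential is infinite. -/
def infiniteSites (V : (Fin d → ℤ) → OnePoint ℝ) : Set (Fin d → ℤ) :=
  {n | V n = OnePoint.infty}

/-- The Hilbert space `ℓ²(ℤ^d ∖ I(V))`. -/
abbrev FiniteL2 (V : (Fin d → ℤ) → OnePoint ℝ) : Type :=
  lp (fun _ : ↥((infiniteSites V)ᶜ) => ℂ) 2

/-- The real value of a finite point of the extended line (and `0` at `∞`). -/
def realValue (v : OnePoint ℝ) : ℝ := v.elim 0 id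

open Classical in
/-- Extension by zero of a function on `ℤ^d ∖ I(V)` to `ℤ^d`. -/
def extendZero (V : (Fin d → ℤ) → OnePoint ℝ) (ψ : ↥((infiniteSites V)ᶜ) → ℂ)
    (n : Fin d → ℤ) : ℂ :=
  if h : n ∈ (infiniteSites V)ᶜ then ψ ⟨n, h⟩ else 0

theorem extendZero_add (V : (Fin d → ℤ) → OnePoint ℝ) (ψ χ : ↥((infiniteSites V)ᶜ) → ℂ)
    (n : Fin d → ℤ) : extendZero V (ψ + χ) n = extendZero V ψ n + extendZero V χ n := by
  unfold extendZero; split_ifs <;> simp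

theorem extendZero_smul (V : (Fin d → ℤ) → OnePoint ℝ) (c : ℂ) (ψ : ↥((infiniteSites V)ᶜ) → ℂ)
    (n : Fin d → ℤ) : extendZero V (c • ψ) n = c * extendZero V ψ n := by
  unfold extendZero; split_ifs <;> simp

theorem lap_extendZero_add (V : (Fin d → ℤ) → OnePoint ℝ) (ψ χ : ↥((infiniteSites V)ᶜ) → ℂ)
    (n : Fin d → ℤ) :
    lap (extendZero V (ψ + χ)) n = lap (extendZero V ψ) n + lap (extendZero V χ) n := by
  simp only [lap, extendZero_add, ← Finset.sum_add_distrib]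
  exact Finset.sum_congr rfl fun i _ => by ring

theorem lap_extendZero_smul (V : (Fin d → ℤ) → OnePoint ℝ) (c : ℂ)
    (ψ : ↥((infiniteSites V)ᶜ) → ℂ) (n : Fin d → ℤ) :
    lap (extendZero V (c • ψ)) n = c * lap (extendZero V ψ) n := by
  simp only [lap, extendZero_smul, Finset.mul_sum]
  exact Finset.sum_congr rfl fun i _ => by ring

/-- The domain of the Schrödinger operator: `ψ ∈ ℓ²(ℤ^d ∖ I(V))` with `Vψ ∈ ℓ²`. -/
def schrodingerDomain (V : (Fin d → ℤ) → OnePoint ℝ) : Submodule ℂ (FiniteL2 V) where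
  carrier := {ψ | Memℓp (fun n : ↥((infiniteSites V)ᶜ) => (realValue (V n) : ℂ) * ψ n) 2}
  zero_mem' := by
    have h : Memℓp (fun _ : ↥((infiniteSites V)ᶜ) => (0 : ℂ)) 2 := zero_memℓp
    simpa using h
  add_mem' := by
    intro ψ χ hψ hχ
    have h := Memℓp.add (show Memℓp _ 2 from hψ) (show Memℓp _ 2 from hχ)
    simpa [Pi.add_def, mul_add] using h
  smul_mem' := by
    intro c ψ hψ
    have h := Memℓp.const_smul (show Memℓp _ 2 from hψ) c
    simpa [Pi.smul_def, mul_left_comm] using h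

theorem memℓp_lap (V : (Fin d → ℤ) → OnePoint ℝ) (ψ : FiniteL2 V) :
    Memℓp (fun n : ↥((infiniteSites V)ᶜ) => lap (extendZero V ψ) n) 2 := by
  have h2 : 0 < (2 : ENNReal).toReal := by norm_num
  have hs : Summable fun n => ‖extendZero V ψ n‖ ^ (2 : ENNReal).toReal := by
    have h1 := (memℓp_gen_iff h2).1 (lp.memℓp ψ)
    refine (Function.Injective.summable_iff (Subtype.val_injective (p := (· ∈ (infiniteSites V)ᶜ)))
      ?_).1 (h1.congr fun n => ?_)
    · intro n hn
      have : n ∉ (infiniteSites V)ᶜ := fun h => hn ⟨⟨n, h⟩, rfl⟩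
      simp [extendZero, this]
    · have : (n : Fin d → ℤ) ∈ (infiniteSites V)ᶜ := n.2
      simp only [Function.comp_apply, extendZero, dif_pos this]
  have hshift : ∀ e : (Fin d → ℤ) ≃ (Fin d → ℤ),
      Memℓp (fun n : ↥((infiniteSites V)ᶜ) => extendZero V ψ (e n)) 2 := fun e =>
    (memℓp_gen_iff h2).2 (((e.summable_iff).2 hs).comp_injective Subtype.val_injective)
  have hterm : ∀ i : Fin d, Memℓp (fun n : ↥((infiniteSites V)ᶜ) =>
      extendZero V ψ ((n : Fin d → ℤ) + Pi.single i 1)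
        + extendZero V ψ ((n : Fin d → ℤ) - Pi.single i 1)) 2 := fun i =>
    (hshift (Equiv.addRight (Pi.single i 1))).add (hshift (Equiv.subRight (Pi.single i 1)))
  exact Memℓp.finsetSum Finset.univ fun i _ => hterm i

/-- The Schrödinger operator `H = Δ + V` as an unbounded operator in `ℓ²(ℤ^d ∖ I(V))`:
`(Hψ)(n) = (Δψ)(n) + V(n)ψ(n)` for `n ∉ I(V)`, where `ψ = 0` on `I(V)`. -/
def schrodinger (V : (Fin d → ℤ) → OnePoint ℝ) : FiniteL2 V →ₗ.[ℂ] FiniteL2 V where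
  domain := schrodingerDomain V
  toFun :=
    { toFun := fun ψ => ⟨fun n => lap (extendZero V (ψ : FiniteL2 V)) n
          + (realValue (V n) : ℂ) * (ψ : FiniteL2 V) n, (memℓp_lap V ψ).add ψ.2⟩
      map_add' := by
        intro ψ χ
        ext n
        change lap (extendZero V (⇑(ψ : FiniteL2 V) + ⇑(χ : FiniteL2 V))) n
            + (realValue (V n) : ℂ) * ((ψ : FiniteL2 V) n + (χ : FiniteL2 V) n)
          = (lap (extendZero V (ψ : FiniteL2 V)) n + (realValue (V n) : ℂ) * (ψ : FiniteL2 V) n)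
            + (lap (extendZero V (χ : FiniteL2 V)) n + (realValue (V n) : ℂ) * (χ : FiniteL2 V) n)
        rw [lap_extendZero_add]
        ring
      map_smul' := by
        intro c ψ
        ext n
        change lap (extendZero V (c • ⇑(ψ : FiniteL2 V))) n
            + (realValue (V n) : ℂ) * (c * (ψ : FiniteL2 V) n)
          = c * (lap (extendZero V (ψ : FiniteL2 V)) n
            + (realValue (V n) : ℂ) * (ψ : FiniteL2 V) n)
        rw [lap_extendZero_smul]
        ring }

/-- The spectrum `σ(H)` of `H = Δ + V`. The operator is self-adjoint, so its spectrum is a set of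
real numbers. -/
def realSpectrum (V : (Fin d → ℤ) → OnePoint ℝ) : Set ℝ :=
  {E | (E : ℂ) ∈ spectrumPMap (schrodinger V)}

open Classical in
/-- The generalized spectrum of `H = Δ + V`: the closure of `σ(H)` in the extended line if `V` is
finite everywhere, and `σ(H) ∪ {∞}` otherwise. -/
def genSpectrum (V : (Fin d → ℤ) → OnePoint ℝ) : Set (OnePoint ℝ) :=
  if infiniteSites V = ∅ then closure ((fun E : ℝ => (E : OnePoint ℝ)) '' realSpectrum V)
  else (fun E : ℝ => (E : OnePoint ℝ)) '' realSpectrum V ∪ {OnePoint.infty}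

/-- The quasiperiodic potential `n ↦ F (x + n · α)` on `ℤ^d`. -/
def qpPotential (F : ℝ → OnePoint ℝ) (α : Fin d → ℝ) (x : ℝ) (n : Fin d → ℤ) : OnePoint ℝ :=
  F (x + ∑ i, (n i : ℝ) * α i)

end GapFilling

end

/-!
Every energy `E` is attained by a winding argument for periodic approximations. In angular
coordinates `V = cot θ` the extended line is the projective line, and the equation
`(Δ + V) ψ = E ψ` becomes `sin θ · (Δ - E) ψ + cos θ · ψ = 0` (`angleDefect`), with bounded
coefficients and no special role for `∞`. Since `f̃` is not null-homotopic, its angle lifts to a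
function `Θ` on `ℝ` with `Θ (y + 2) = Θ y + D π` and `D ≠ 0` (`exists_angle_lift_circle`).

Replace `α` by rational frequencies and squeeze the arc into a short interval, so that the angle at
each site depends continuously on the phase `x`. On the finite torus all these angles increase by
`D π` as `x` increases by `1`. If `E` were an eigenvalue for no phase, the determinant of the
equation would not vanish along the homotopy that switches off `Δ` and moves `E` to `i`: off the
real axis a symmetric matrix has no eigenvalue. Its argument would then change by the same amount at
both ends, which is zero at the real end and a nonzero multiple of `π` at the other
(`exists_det_angleMatrix_eq_zero`). So there are periodic solutions at the energy `E`, normalized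
to have their maximal modulus `1` at the origin. The rational frequencies are chosen to satisfy all
integer relations between `1` and the components of `α` (`exists_rational_functionals`). Hence, in a
limit along an ultrafilter, all sites at which the limit phase hits the discontinuity see the same
point `t` of the arc, and the limit is a bounded solution for the potential `f_t (y + n · α)`
(`exists_bounded_solution`).

Cutting a bounded solution off to a suitable box gives approximate eigenvectors, because square sums
over boxes grow polynomially. The potential `f_t (y + n · α)` is locally a limit of translates of
`f_t (n · α)`, so these eigenvectors can be transplanted, and `E` belongs to the spectrum of
`H_t(0)` (`mem_realSpectrum_of_local_limit`).

The point `∞` either lies on the arc or is a limit of values of `V_t`. In the latter case, if `V_t`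
is everywhere finite, each of its values is within `2d` of the spectrum, because the resolvent is
self-adjoint and its norm is its spectral radius (`exists_mem_realSpectrum_near`).
-/

noncomputable section

namespace GapFilling

/-! ### Logarithms of nowhere vanishing functions -/

theorem exists_continuous_exp_eq {X : Type*} [TopologicalSpace X] [SimplyConnectedSpace X]
    [LocallyPathConnectedSpace X] {g : X → ℂ} (hg : Continuous g) (h0 : ∀ x, g x ≠ 0) :
    ∃ L : X → ℂ, Continuous L ∧ ∀ x, Complex.exp (L x) = g x := by
  have x₀ : X := Classical.arbitrary X
  obtain ⟨F, ⟨-, hF⟩, -⟩ := Complex.isCoveringMapOn_exp.existsUnique_continuousMap_lifts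
    ⟨g, hg⟩ (a₀ := x₀) (Complex.exp_log (h0 x₀)) h0
  exact ⟨F, F.continuous, fun x => congr_fun hF x⟩

theorem eq_of_exp_const {X : Type*} [TopologicalSpace X] [PreconnectedSpace X] {g : X → ℂ}
    (hg : Continuous g) (h : ∀ x y, Complex.exp (g x) = Complex.exp (g y)) (x y : X) :
    g x = g y :=
  Complex.isCoveringMap_exp.const_of_comp hg (fun a b => Subtype.ext (h a b)) x y

/-! ### The extended line as the projective line -/

/-- The point `[cos θ : sin θ]` of the extended line, seen as the real projective line. Using
angles makes `∞` an ordinary point: it is the value at the zeros of `sin`. -/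
def cotOnePoint (θ : ℝ) : OnePoint ℝ :=
  if Real.sin θ = 0 then OnePoint.infty else ((Real.cos θ / Real.sin θ : ℝ) : OnePoint ℝ)

/-- The Cayley transform `c ↦ (c + i) / (c - i)`, which embeds the extended line in `ℂ`. -/
def cayley (v : OnePoint ℝ) : ℂ :=
  v.elim 1 fun c : ℝ => ((c : ℂ) + Complex.I) / ((c : ℂ) - Complex.I)

theorem ofReal_sub_I_ne_zero (c : ℝ) : (c : ℂ) - Complex.I ≠ 0 := fun h => by
  simpa using congrArg Complex.im h

theorem cayley_coe (c : ℝ) :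
    cayley (c : OnePoint ℝ) = ((c : ℂ) + Complex.I) / ((c : ℂ) - Complex.I) := rfl

theorem cayley_infty : cayley OnePoint.infty = 1 := rfl

theorem cayley_coe_eq (c : ℝ) :
    cayley (c : OnePoint ℝ) = 1 + 2 * Complex.I * ((c : ℂ) - Complex.I)⁻¹ := by
  have := ofReal_sub_I_ne_zero c
  rw [cayley_coe]
  field_simp
  ring

theorem continuous_cayley : Continuous cayley := by
  rw [OnePoint.continuous_iff]
  constructor
  · rw [coclosedCompact_eq_cocompact, cayley_infty]
    have h1 : Tendsto (fun c : ℝ => (c : ℂ) - Complex.I) (cocompact ℝ) (cocompact ℂ) := by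
      have h2 : Tendsto (fun c : ℝ => (c : ℂ)) (cocompact ℝ) (cocompact ℂ) :=
        Complex.isometry_ofReal.isClosedEmbedding.tendsto_cocompact
      exact ((Homeomorph.subRight Complex.I).isClosedEmbedding.tendsto_cocompact).comp h2
    have h3 := (tendsto_inv₀_cobounded (α := ℂ))
    rw [Metric.cobounded_eq_cocompact] at h3
    have h4 := ((h3.comp h1).const_mul (2 * Complex.I)).const_add 1
    simpa [cayley_coe_eq, Function.comp_def] using h4
  · have : Continuous fun c : ℝ => ((c : ℂ) + Complex.I) / ((c : ℂ) - Complex.I) :=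
      Continuous.div (by fun_prop) (by fun_prop) ofReal_sub_I_ne_zero
    exact this

theorem cayley_injective : Function.Injective cayley := by
  intro v w h
  induction v using OnePoint.rec with
  | infty =>
    induction w using OnePoint.rec with
    | infty => rfl
    | coe c =>
      rw [cayley_infty, cayley_coe_eq] at h
      simp [ofReal_sub_I_ne_zero] at h
  | coe b =>
    induction w using OnePoint.rec with
    | infty =>
      rw [cayley_infty, cayley_coe_eq] at h
      simp [ofReal_sub_I_ne_zero] at h
    | coe c =>
      rw [cayley_coe_eq, cayley_coe_eq] at h
      simpa using h

theorem cayley_ne_zero (v : OnePoint ℝ) : cayley v ≠ 0 := by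
  induction v using OnePoint.rec with
  | infty => simp [cayley_infty]
  | coe c =>
    rw [cayley_coe]
    refine div_ne_zero (fun h => ?_) (ofReal_sub_I_ne_zero c)
    simpa using congrArg Complex.im h

theorem norm_cayley (v : OnePoint ℝ) : ‖cayley v‖ = 1 := by
  induction v using OnePoint.rec with
  | infty => simp [cayley_infty]
  | coe c =>
    rw [cayley_coe, norm_div, div_eq_one_iff_eq (norm_ne_zero_iff.2 (ofReal_sub_I_ne_zero c))]
    have : (c : ℂ) - Complex.I = (starRingEnd ℂ) ((c : ℂ) + Complex.I) := by simp [sub_eq_add_neg]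
    rw [this, Complex.norm_conj]

theorem cayley_cotOnePoint (θ : ℝ) : cayley (cotOnePoint θ) = Complex.exp (2 * θ * Complex.I) := by
  have h2 : Complex.exp (2 * θ * Complex.I)
      = (Complex.cos θ + Complex.sin θ * Complex.I) ^ 2 := by
    rw [← Complex.exp_mul_I, ← Complex.exp_nat_mul]
    congr 1
    push_cast
    ring
  have hcs : (Complex.sin θ) ^ 2 + (Complex.cos θ) ^ 2 = 1 := Complex.sin_sq_add_cos_sq _
  unfold cotOnePoint
  split_ifs with h
  · have h' : Complex.sin θ = 0 := by rw [← Complex.ofReal_sin, h, Complex.ofReal_zero]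
    rw [cayley_infty, h2, h']
    rw [h'] at hcs
    linear_combination -hcs
  · have h' : Complex.sin θ ≠ 0 := by
      rw [← Complex.ofReal_sin]
      exact_mod_cast h
    have h3 : Complex.cos θ - Complex.sin θ * Complex.I ≠ 0 := by
      intro h4
      have : (Complex.cos θ - Complex.sin θ * Complex.I)
          * (Complex.cos θ + Complex.sin θ * Complex.I) = 1 := by
        linear_combination hcs - Complex.sin θ ^ 2 * Complex.I_sq
      rw [h4, zero_mul] at this
      exact zero_ne_one this
    have h5 : Complex.cos θ / Complex.sin θ - Complex.I ≠ 0 := by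
      intro h4
      apply h3
      field_simp at h4
      simpa using h4
    rw [cayley_coe, h2]
    push_cast
    rw [div_eq_iff h5]
    field_simp
    linear_combination (-(Complex.cos θ) - Complex.sin θ * Complex.I) * hcs
      + (Complex.cos θ + Complex.sin θ * Complex.I) * Complex.sin θ ^ 2 * Complex.I_sq

theorem continuous_cotOnePoint : Continuous cotOnePoint := by
  have h : IsClosedEmbedding cayley := continuous_cayley.isClosedEmbedding cayley_injective
  rw [h.isInducing.continuous_iff]
  have : cayley ∘ cotOnePoint = fun θ : ℝ => Complex.exp (2 * θ * Complex.I) :=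
    funext cayley_cotOnePoint
  rw [this]
  fun_prop

theorem exists_angle_lift {g : ℝ → OnePoint ℝ} (hg : Continuous g) :
    ∃ Θ : ℝ → ℝ, Continuous Θ ∧ ∀ y, cotOnePoint (Θ y) = g y := by
  obtain ⟨L, hL, hLe⟩ := exists_continuous_exp_eq (continuous_cayley.comp hg)
    fun x => cayley_ne_zero (g x)
  refine ⟨fun y => (L y).im / 2, by fun_prop, fun y => cayley_injective ?_⟩
  rw [cayley_cotOnePoint]
  have h1 : (L y).re = 0 := by
    have : Real.exp (L y).re = 1 := by
      rw [← Complex.norm_exp, hLe]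
      exact norm_cayley _
    simpa using this
  have h2 := hLe y
  rw [← Complex.re_add_im (L y), h1] at h2
  simp only [Complex.ofReal_zero, zero_add, Function.comp_apply] at h2
  rw [← h2]
  congr 1
  push_cast
  ring

/-- The angle along a circle map that is not null-homotopic increases by a nonzero multiple of
`π` in one turn. -/
theorem exists_angle_lift_circle (G : C(AddCircle (2 : ℝ), OnePoint ℝ)) (hG : ¬ G.Nullhomotopic) :
    ∃ (Θ : ℝ → ℝ) (D : ℤ), Continuous Θ ∧ D ≠ 0 ∧ (∀ y : ℝ, cotOnePoint (Θ y) = G y) ∧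
      ∀ y, Θ (y + 2) = Θ y + D * Real.pi := by
  obtain ⟨Θ, hΘ, hG'⟩ := exists_angle_lift (g := fun y : ℝ => G y)
    (G.continuous.comp (AddCircle.continuous_mk' 2))
  have hexp : ∀ y, Complex.exp (2 * Complex.I * (Θ (y + 2) - Θ y : ℝ)) = 1 := by
    intro y
    have h1 : cotOnePoint (Θ (y + 2)) = cotOnePoint (Θ y) := by
      rw [hG', hG']
      congr 1
      simp
    have h2 := congrArg cayley h1
    rw [cayley_cotOnePoint, cayley_cotOnePoint] at h2
    have h3 : 2 * Complex.I * (Θ (y + 2) - Θ y : ℝ)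
        = 2 * (Θ (y + 2) : ℂ) * Complex.I - 2 * (Θ y : ℂ) * Complex.I := by
      push_cast
      ring
    rw [h3, Complex.exp_sub, h2, div_self (Complex.exp_ne_zero _)]
  have hconst : ∀ y, Θ (y + 2) - Θ y = Θ (0 + 2) - Θ 0 := by
    intro y
    have h := eq_of_exp_const (g := fun y => 2 * Complex.I * (Θ (y + 2) - Θ y : ℝ))
      (by fun_prop) (fun a b => (hexp a).trans (hexp b).symm) y 0
    exact_mod_cast mul_left_cancel₀ (mul_ne_zero two_ne_zero Complex.I_ne_zero) h
  obtain ⟨D, hD⟩ := Complex.exp_eq_one_iff.1 (hexp 0)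
  have hD' : Θ (0 + 2) - Θ 0 = D * Real.pi := by
    have h1 : ((Θ (0 + 2) - Θ 0 : ℝ) : ℂ) = ((D * Real.pi : ℝ) : ℂ) := by
      have h2 : (2 * Complex.I) ≠ 0 := by simp
      apply mul_left_cancel₀ h2
      rw [hD]
      push_cast
      ring
    exact_mod_cast h1
  have hper : ∀ y, Θ (y + 2) = Θ y + D * Real.pi := fun y => by
    linarith [hconst y]
  refine ⟨Θ, D, hΘ, ?_, hG', hper⟩
  rintro rfl
  apply hG
  have hp : Function.Periodic Θ 2 := fun y => by simpa using hper y
  let Θ' : C(AddCircle (2 : ℝ), ℝ) :=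
    ⟨hp.lift, by
      rw [(QuotientAddGroup.isQuotientMap_mk (N := AddSubgroup.zmultiples (2 : ℝ))).continuous_iff]
      exact hΘ⟩
  have hcomp : G = (ContinuousMap.mk cotOnePoint continuous_cotOnePoint).comp Θ' := by
    ext x
    obtain ⟨y, rfl⟩ := QuotientAddGroup.mk_surjective x
    exact (hG' y).symm
  rw [hcomp]
  have hid : (ContinuousMap.id ℝ).Nullhomotopic := id_nullhomotopic ℝ
  have := (hid.comp_left Θ').comp_right ⟨cotOnePoint, continuous_cotOnePoint⟩
  simpa using this

/-! ### Winding of determinants -/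

section Winding

variable {ι : Type*} [Fintype ι] [DecidableEq ι]

/-- The matrix `sin θ · B + cos θ`. Its kernel consists of the solutions of `(B + V) ψ = 0` for the
diagonal potential `V = cot θ`, with `ψ = 0` at the sites where `V = ∞`. -/
def angleMatrix (B : Matrix ι ι ℂ) (θ : ι → ℝ) : Matrix ι ι ℂ :=
  Matrix.diagonal (fun n => (Real.sin (θ n) : ℂ)) * B
    + Matrix.diagonal (fun n => (Real.cos (θ n) : ℂ))

theorem angleMatrix_add_int_mul_pi (B : Matrix ι ι ℂ) (θ : ι → ℝ) (D : ℤ) :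
    angleMatrix B (fun n => θ n + D * Real.pi) = ((-1 : ℂ) ^ D) • angleMatrix B θ := by
  ext i j
  simp only [angleMatrix, Matrix.add_apply, Matrix.diagonal_mul, Real.sin_add_int_mul_pi,
    Real.cos_add_int_mul_pi, Matrix.smul_apply, smul_eq_mul, Matrix.diagonal_apply]
  split_ifs <;> push_cast <;> ring

/-- A symmetric operator has no eigenvalue off the real axis. -/
theorem det_angleMatrix_ne_zero {A : Matrix ι ι ℝ} (hA : A.IsSymm) (s : ℝ) {z : ℂ}
    (hz : 0 < z.im) (θ : ι → ℝ) :
    (angleMatrix ((s : ℂ) • A.map ((↑) : ℝ → ℂ) - z • 1) θ).det ≠ 0 := by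
  intro h
  obtain ⟨v, hv0, hv⟩ := Matrix.exists_vecMul_eq_zero_iff.2 h
  set w : ι → ℂ := fun n => v n * Real.sin (θ n) with hw
  have hcol : ∀ m, (∑ n, s * (A n m * w n)) - z * w m + v m * Real.cos (θ m) = 0 := by
    intro m
    have h1 := congr_fun hv m
    rw [Matrix.vecMul, dotProduct] at h1
    simp only [angleMatrix, Matrix.add_apply, Matrix.diagonal_mul, Matrix.sub_apply,
      Matrix.smul_apply, Matrix.map_apply, smul_eq_mul, Matrix.one_apply, Matrix.diagonal_apply,
      Pi.zero_apply] at h1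
    rw [← h1]
    have h2 : ∀ n, v n * ((Real.sin (θ n) : ℂ) * (s * A n m - z * if n = m then 1 else 0)
        + if n = m then (Real.cos (θ n) : ℂ) else 0)
        = s * (A n m * w n) - (if n = m then z * w n else 0)
          + (if n = m then v n * Real.cos (θ n) else 0) := by
      intro n
      split_ifs <;> simp only [hw] <;> ring
    rw [Finset.sum_congr rfl fun n _ => h2 n, Finset.sum_add_distrib, Finset.sum_sub_distrib]
    simp
  have hform : ∑ m, (starRingEnd ℂ) (w m) * ∑ n, s * (A n m * w n)
      = z * ((∑ m, Complex.normSq (w m) : ℝ) : ℂ)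
        - ((∑ m, Real.cos (θ m) * Real.sin (θ m) * Complex.normSq (v m) : ℝ) : ℂ) := by
    push_cast
    rw [Finset.mul_sum, ← Finset.sum_sub_distrib]
    refine Finset.sum_congr rfl fun m _ => ?_
    have h1 : ∑ n, s * (A n m * w n) = z * w m - v m * Real.cos (θ m) := by
      linear_combination hcol m
    rw [h1, Complex.normSq_eq_conj_mul_self, Complex.normSq_eq_conj_mul_self]
    simp only [hw, map_mul, ← Complex.ofReal_cos, ← Complex.ofReal_sin, Complex.conj_ofReal]
    ring
  have hreal : (∑ m, (starRingEnd ℂ) (w m) * ∑ n, s * (A n m * w n)).im = 0 := by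
    rw [← Complex.conj_eq_iff_im, map_sum]
    simp only [map_mul, map_sum, Complex.conj_conj, Complex.conj_ofReal, Finset.mul_sum]
    rw [Finset.sum_comm]
    refine Finset.sum_congr rfl fun m _ => Finset.sum_congr rfl fun n _ => ?_
    rw [hA.apply n m]
    ring
  rw [hform] at hreal
  simp only [Complex.sub_im, Complex.mul_im, Complex.ofReal_im, Complex.ofReal_re, mul_zero,
    zero_add, sub_zero, mul_eq_zero, hz.ne', false_or] at hreal
  rw [Finset.sum_eq_zero_iff_of_nonneg fun m _ => Complex.normSq_nonneg _] at hreal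
  have hw0 : ∀ m, w m = 0 := fun m => Complex.normSq_eq_zero.1 (hreal m (Finset.mem_univ m))
  refine hv0 (funext fun m => ?_)
  have h1 : v m * Real.cos (θ m) = 0 := by simpa [hw0] using hcol m
  have h2 : v m * Real.sin (θ m) = 0 := hw0 m
  by_contra hvm
  have h3 : Real.cos (θ m) = 0 := by simpa [show v m ≠ 0 from hvm, -Complex.ofReal_cos] using h1
  have h4 : Real.sin (θ m) = 0 := by simpa [show v m ≠ 0 from hvm, -Complex.ofReal_sin] using h2
  simpa [h3, h4] using Real.sin_sq_add_cos_sq (θ m)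

/-- If all the angles wind by the same nonzero multiple of `π`, then every real energy is an
eigenvalue for some parameter. Otherwise the determinant of `sin θ · (s A - z) + cos θ` has no zero
along the path from `(s, z) = (0, i)` to `(1, E)`, so that its winding number is the same at both
ends. At `(0, i)` the determinant is the product of the `e ^ (-i θ n)`, and at `(1, E)` it is
real. -/
theorem exists_det_angleMatrix_eq_zero [Nonempty ι] {A : Matrix ι ι ℝ} (hA : A.IsSymm)
    {θ : ι → ℝ → ℝ} (hθ : ∀ n, Continuous (θ n)) {D : ℤ} (hD : D ≠ 0)
    (hper : ∀ n x, θ n (x + 1) = θ n x + D * Real.pi) (E : ℝ) :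
    ∃ x, (angleMatrix (A.map ((↑) : ℝ → ℂ) - (E : ℂ) • 1) fun n => θ n x).det = 0 := by
  by_contra! hne
  let c : ℝ → ℝ := fun s => max 0 (min s 1)
  have hc : Continuous c := by fun_prop
  let B : ℝ → Matrix ι ι ℂ := fun s =>
    (s : ℂ) • A.map ((↑) : ℝ → ℂ) - ((s * E : ℝ) + (1 - s : ℝ) * Complex.I) • 1
  let F : ℝ × ℝ → ℂ := fun p => (angleMatrix (B (c p.1)) fun n => θ n p.2).det
  have hB1 : B 1 = A.map ((↑) : ℝ → ℂ) - (E : ℂ) • 1 := by simp [B]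
  have hF : Continuous F := by
    refine Continuous.matrix_det ?_
    unfold angleMatrix
    fun_prop
  have hF0 : ∀ p, F p ≠ 0 := by
    intro p
    rcases lt_or_ge p.1 1 with h | h
    · refine det_angleMatrix_ne_zero hA _ ?_ _
      have : c p.1 < 1 := max_lt one_pos ((min_le_left _ _).trans_lt h)
      simpa using this
    · have : c p.1 = 1 := by simp [c, h]
      simp only [F, this, hB1]
      exact hne p.2
  obtain ⟨L, hL, hLF⟩ := exists_continuous_exp_eq hF hF0
  have hmono : ∀ s, Complex.exp (L (s, 1) - L (s, 0)) = ((-1 : ℂ) ^ D) ^ Fintype.card ι := by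
    intro s
    have h1 : F (s, 1) = ((-1 : ℂ) ^ D) ^ Fintype.card ι * F (s, 0) := by
      simp only [F]
      have h2 : (fun n => θ n 1) = fun n => θ n 0 + D * Real.pi := by
        funext n
        simpa using hper n 0
      rw [h2, angleMatrix_add_int_mul_pi, Matrix.det_smul]
    rw [Complex.exp_sub, hLF, hLF, h1, mul_div_assoc, div_self (hF0 _), mul_one]
  have hM : L (1, 1) - L (1, 0) = L (0, 1) - L (0, 0) :=
    eq_of_exp_const (g := fun s : ℝ => L (s, 1) - L (s, 0)) (by fun_prop)
      (fun a b => (hmono a).trans (hmono b).symm) 1 0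
  have hL0 : L (0, 1) - L (0, 0) = -(Complex.I * (Fintype.card ι * (D * Real.pi))) := by
    have hexp : ∀ x, Complex.exp (L (0, x) + Complex.I * ∑ n, (θ n x : ℂ)) = 1 := by
      intro x
      have h1 : F (0, x) = ∏ n, Complex.exp (-(Complex.I * θ n x)) := by
        have h2 : angleMatrix (B (c 0)) (fun n => θ n x)
            = Matrix.diagonal fun n => Complex.exp (-(Complex.I * θ n x)) := by
          ext i j
          have h3 : Complex.exp (-(Complex.I * θ i x))
              = Complex.cos (θ i x) - Complex.sin (θ i x) * Complex.I := by
            rw [show -(Complex.I * (θ i x : ℂ)) = (-(θ i x) : ℂ) * Complex.I by ring,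
              Complex.exp_mul_I]
            simp [sub_eq_add_neg]
          by_cases hij : i = j
          · subst hij
            simp [angleMatrix, B, c, h3]
            ring
          · simp [angleMatrix, B, c, hij]
        simp only [F, h2, Matrix.det_diagonal]
      rw [Complex.exp_add, hLF, h1, Finset.mul_sum, Complex.exp_sum, ← Finset.prod_mul_distrib]
      refine Finset.prod_eq_one fun n _ => ?_
      rw [← Complex.exp_add]
      simp
    have h := eq_of_exp_const (g := fun x : ℝ => L (0, x) + Complex.I * ∑ n, (θ n x : ℂ))
      (by fun_prop) (fun a b => (hexp a).trans (hexp b).symm) 1 0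
    have hsum : ∑ n, (θ n 1 : ℂ) = ∑ n, (θ n 0 : ℂ) + Fintype.card ι * (D * Real.pi) := by
      have h1 : ∀ n, (θ n 1 : ℂ) = θ n 0 + D * Real.pi := fun n => by
        have := hper n 0
        rw [zero_add] at this
        rw [this]
        push_cast
        rfl
      simp [h1, Finset.sum_add_distrib]
    simp only [hsum] at h
    linear_combination h
  have hL1 : (L (1, 1) - L (1, 0)).im = 0 := by
    have hreal : ∀ x, (starRingEnd ℂ) (F (1, x)) = F (1, x) := by
      intro x
      simp only [F, show c 1 = 1 by simp [c], hB1]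
      rw [RingHom.map_det]
      congr 1
      ext i j
      simp only [angleMatrix, RingHom.mapMatrix_apply, Matrix.map_apply, Matrix.add_apply,
        Matrix.diagonal_mul, Matrix.sub_apply, Matrix.smul_apply, Matrix.one_apply,
        Matrix.diagonal_apply, smul_eq_mul]
      split_ifs <;> simp [-Complex.ofReal_sin, -Complex.ofReal_cos]
    have hexp : ∀ x, Complex.exp (L (1, x) - (starRingEnd ℂ) (L (1, x))) = 1 := by
      intro x
      rw [Complex.exp_sub, Complex.exp_conj, hLF, hreal, div_self (hF0 _)]
    have h := eq_of_exp_const (g := fun x : ℝ => L (1, x) - (starRingEnd ℂ) (L (1, x)))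
      (by have := Complex.continuous_conj; fun_prop)
      (fun a b => (hexp a).trans (hexp b).symm) 1 0
    have h2 := congrArg Complex.im h
    simp only [Complex.sub_im, Complex.conj_im] at h2 ⊢
    linarith
  rw [hM, hL0] at hL1
  have hcard : (Fintype.card ι : ℝ) ≠ 0 := by exact_mod_cast Fintype.card_ne_zero
  have hDr : (D : ℝ) ≠ 0 := by exact_mod_cast hD
  simp [Real.pi_ne_zero, hDr] at hL1

end Winding

/-! ### Periodic solutions -/

/-- The defect of `ψ` in the equation `(Δ + V) ψ = E ψ` on `ℤ^d` for the potential `V = cot θ`,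
multiplied by `sin θ` so that it depends continuously on the angles. It vanishes at a site where
`V = ∞` when `ψ` does, and at the other sites when the equation holds. -/
def angleDefect {d : ℕ} (E : ℝ) (θ : (Fin d → ℤ) → ℝ) (ψ : (Fin d → ℤ) → ℂ) (n : Fin d → ℤ) : ℂ :=
  Real.sin (θ n) * (lap ψ n - E * ψ n) + Real.cos (θ n) * ψ n

theorem angleDefect_add_int_mul_pi {d : ℕ} {E : ℝ} {θ θ' : (Fin d → ℤ) → ℝ}
    (ψ : (Fin d → ℤ) → ℂ) (n : Fin d → ℤ) (D : ℤ) (h : θ' n = θ n + D * Real.pi) :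
    angleDefect E θ' ψ n = (-1) ^ D * angleDefect E θ ψ n := by
  simp only [angleDefect, h, Real.sin_add_int_mul_pi, Real.cos_add_int_mul_pi]
  push_cast
  ring

theorem add_int_mul_pi_of_period {Φ : ℝ → ℝ} {D : ℤ}
    (hper : ∀ x, Φ (x + 1) = Φ x + D * Real.pi) (x : ℝ) (j : ℤ) :
    Φ (x + j) = Φ x + (D * j : ℤ) * Real.pi := by
  induction j using Int.induction_on with
  | zero => simp
  | succ j ih =>
    have := hper (x + j)
    push_cast at ih ⊢
    rw [← add_assoc, this, ih]
    ring
  | pred j ih =>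
    have := hper (x + (-j - 1))
    push_cast at ih ⊢
    rw [show x + (-(j : ℝ) - 1) + 1 = x + -j by ring, ih] at this
    linear_combination -this

theorem exists_common_denominator {d : ℕ} (a : Fin d → ℚ) :
    ∃ (q : ℕ) (p : Fin d → ℤ), 0 < q ∧ ∀ i, (a i : ℝ) * q = p i := by
  obtain ⟨q, hq⟩ := IsLocalization.exist_integer_multiples_of_finite (nonZeroDivisors ℤ) a
  choose p hp using hq
  have hq0 : (q : ℤ) ≠ 0 := nonZeroDivisors.coe_ne_zero q
  refine ⟨(q : ℤ).natAbs, fun i => (q : ℤ).sign * p i, Int.natAbs_pos.2 hq0, fun i => ?_⟩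
  have h1 : ((q : ℤ).natAbs : ℝ) = ((q : ℤ).sign : ℝ) * ((q : ℤ) : ℝ) := by
    rw [← Int.cast_mul, Int.sign_mul_self_eq_natAbs, Int.cast_natCast]
  have h2 : ((p i : ℚ) : ℝ) = ((((q : ℤ) : ℚ) * a i : ℚ) : ℝ) := by
    have := hp i
    simp only [algebraMap_int_eq, eq_intCast, zsmul_eq_mul] at this
    rw [this]
  push_cast at h2
  rw [h1, Int.cast_mul, h2]
  ring

/-- For rational frequencies and a phase function that winds nontrivially, every energy admits a
periodic solution for some phase. The solution is translated so that its modulus is largest at the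
origin. -/
theorem exists_periodic_solution {d : ℕ} {Φ : ℝ → ℝ} (hΦ : Continuous Φ) {D : ℤ} (hD : D ≠ 0)
    (hper : ∀ x, Φ (x + 1) = Φ x + D * Real.pi) (a : Fin d → ℚ) (E : ℝ) :
    ∃ (x : ℝ) (ψ : (Fin d → ℤ) → ℂ), (∀ n, ‖ψ n‖ ≤ 1) ∧ ‖ψ 0‖ = 1 ∧
      ∀ n, angleDefect E (fun n => Φ (x + ∑ i, (n i : ℝ) * a i)) ψ n = 0 := by
  obtain ⟨q, p, hq, hp⟩ := exists_common_denominator a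
  have : NeZero q := ⟨hq.ne'⟩
  let e : Fin d → (Fin d → ZMod q) := fun i => Pi.single i 1
  let A : Matrix (Fin d → ZMod q) (Fin d → ZMod q) ℝ := fun g h =>
    ∑ i, ((if h = g + e i then 1 else 0) + (if h = g - e i then 1 else 0))
  have hAapp : ∀ g h, A g h
      = ∑ i, ((if h = g + e i then 1 else 0) + (if h = g - e i then 1 else 0)) := fun _ _ => rfl
  have hA : A.IsSymm := by
    refine Matrix.IsSymm.ext fun g h => ?_
    rw [hAapp, hAapp]
    refine Finset.sum_congr rfl fun i _ => ?_
    rw [add_comm]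
    simp only [eq_sub_iff_add_eq, eq_comm (a := g)]
    congr 1
    simp only [sub_eq_iff_eq_add]
  let s : (Fin d → ZMod q) → ℝ := fun g => ∑ i, ((g i).val : ℝ) * a i
  obtain ⟨x, hx⟩ := exists_det_angleMatrix_eq_zero hA (θ := fun g x => Φ (x + s g))
    (fun g => by fun_prop) hD
    (fun g x => by rw [show x + 1 + s g = x + s g + 1 by ring, hper]) E
  obtain ⟨v, hv0, hv⟩ := Matrix.exists_mulVec_eq_zero_iff.2 hx
  have hv' : ∀ g, Real.sin (Φ (x + s g)) * (∑ i, (v (g + e i) + v (g - e i)) - E * v g)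
      + Real.cos (Φ (x + s g)) * v g = 0 := by
    intro g
    have h := congr_fun hv g
    have hAv : ∑ k, (A g k : ℂ) * v k = ∑ i, (v (g + e i) + v (g - e i)) := by
      simp only [hAapp]
      push_cast
      simp only [Finset.sum_mul, add_mul]
      rw [Finset.sum_comm]
      refine Finset.sum_congr rfl fun i _ => ?_
      rw [Finset.sum_add_distrib]
      simp only [apply_ite (Complex.ofReal), Complex.ofReal_one, Complex.ofReal_zero, ite_mul,
        one_mul, zero_mul, Finset.sum_ite_eq', Finset.mem_univ, if_true]
    rw [angleMatrix, Matrix.add_mulVec, ← Matrix.mulVec_mulVec, Matrix.sub_mulVec] at h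
    simp only [Pi.add_apply, Matrix.mulVec_diagonal, Pi.sub_apply, Matrix.smul_mulVec,
      Matrix.one_mulVec, Pi.smul_apply, smul_eq_mul, Pi.zero_apply] at h
    rw [← hAv, ← h]
    simp [Matrix.mulVec, dotProduct]
  obtain ⟨g₀, hg₀⟩ := Finite.exists_max fun g => ‖v g‖
  have hpos : 0 < ‖v g₀‖ := by
    obtain ⟨g, hg⟩ := Function.ne_iff.1 hv0
    exact (norm_pos_iff.2 hg).trans_le (hg₀ g)
  let π : (Fin d → ℤ) → (Fin d → ZMod q) := fun n i => g₀ i + (n i : ZMod q)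
  have hπ1 : ∀ n i, π (n + Pi.single i 1) = π n + e i := by
    intro n i
    ext j
    simp only [π, e, Pi.add_apply, Pi.single_apply]
    split_ifs <;> simp [add_assoc]
  have hπ2 : ∀ n i, π (n - Pi.single i 1) = π n - e i := by
    intro n i
    ext j
    simp only [π, e, Pi.sub_apply, Pi.single_apply]
    split_ifs <;> simp [add_sub_assoc]
  have hs : ∀ n, ∃ j : ℤ, s g₀ + ∑ i, (n i : ℝ) * a i = s (π n) + j := by
    intro n
    have h1 : ∀ i, ∃ j : ℤ, ((g₀ i).val : ℤ) + n i = ((π n i).val : ℤ) + q * j := by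
      intro i
      have h2 : (((((g₀ i).val : ℤ) + n i - ((π n i).val : ℤ) : ℤ)) : ZMod q) = 0 := by
        simp [π]
      obtain ⟨j, hj⟩ := (ZMod.intCast_zmod_eq_zero_iff_dvd _ q).1 h2
      exact ⟨j, by linarith⟩
    choose j hj using h1
    refine ⟨∑ i, j i * p i, ?_⟩
    simp only [s]
    push_cast
    rw [← Finset.sum_add_distrib, ← Finset.sum_add_distrib]
    refine Finset.sum_congr rfl fun i _ => ?_
    have h3 : ((g₀ i).val : ℝ) + n i = ((π n i).val : ℝ) + q * j i := by exact_mod_cast hj i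
    rw [← hp i]
    linear_combination (a i : ℝ) * h3
  refine ⟨x + s g₀, fun n => v (π n) / ‖v g₀‖, fun n => ?_, ?_, fun n => ?_⟩
  · rw [norm_div, Complex.norm_real, norm_norm]
    exact div_le_one_of_le₀ (hg₀ _) hpos.le
  · have : π 0 = g₀ := by ext i; simp [π]
    simp only [this]
    rw [norm_div, Complex.norm_real, norm_norm, div_self hpos.ne']
  · obtain ⟨j, hj⟩ := hs n
    have h1 : Φ (x + s g₀ + ∑ i, (n i : ℝ) * a i)
        = Φ (x + s (π n)) + (D * j : ℤ) * Real.pi := by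
      rw [add_assoc, hj, ← add_assoc, add_int_mul_pi_of_period hper]
    rw [angleDefect_add_int_mul_pi (θ := fun m => Φ (x + s (π m))) _ n _ h1]
    have h2 := hv' (π n)
    simp only [angleDefect, lap, hπ1, hπ2]
    have h3 : ∑ i, (v (π n + e i) / (‖v g₀‖ : ℂ) + v (π n - e i) / (‖v g₀‖ : ℂ))
        = (∑ i, (v (π n + e i) + v (π n - e i))) / (‖v g₀‖ : ℂ) := by
      rw [Finset.sum_div]
      exact Finset.sum_congr rfl fun i _ => by ring
    rw [h3]
    linear_combination ((-1) ^ (D * j) / (‖v g₀‖ : ℂ)) * h2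

variable {d : ℕ}

/-! ### Square sums on the lattice -/

/-- The squared `ℓ²` norm of a function on `ℤ^d`, with values in `[0, ∞]`. -/
def sqNorm (w : (Fin d → ℤ) → ℂ) : ENNReal := ∑' n, ENNReal.ofReal (‖w n‖ ^ 2)

theorem sqNorm_mono {v w : (Fin d → ℤ) → ℂ} (h : ∀ n, ‖v n‖ ≤ ‖w n‖) : sqNorm v ≤ sqNorm w :=
  ENNReal.tsum_le_tsum fun n => ENNReal.ofReal_le_ofReal (by gcongr; exact h n)

theorem sqNorm_add_le (v w : (Fin d → ℤ) → ℂ) :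
    sqNorm (fun n => v n + w n) ≤ 2 * sqNorm v + 2 * sqNorm w := by
  unfold sqNorm
  rw [← ENNReal.tsum_mul_left, ← ENNReal.tsum_mul_left, ← ENNReal.tsum_add]
  refine ENNReal.tsum_le_tsum fun n => ?_
  have h2 : (2 : ENNReal) = ENNReal.ofReal 2 := by simp
  rw [h2, ← ENNReal.ofReal_mul zero_le_two, ← ENNReal.ofReal_mul zero_le_two,
    ← ENNReal.ofReal_add (by positivity) (by positivity)]
  refine ENNReal.ofReal_le_ofReal ?_
  nlinarith [norm_add_le (v n) (w n), norm_nonneg (v n + w n), sq_nonneg (‖v n‖ - ‖w n‖)]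

theorem sqNorm_sub_le (v w : (Fin d → ℤ) → ℂ) :
    sqNorm (fun n => v n - w n) ≤ 2 * sqNorm v + 2 * sqNorm w := by
  have h := sqNorm_add_le v fun n => -w n
  have h2 : sqNorm (fun n => -w n) = sqNorm w := by simp [sqNorm]
  simpa [h2, sub_eq_add_neg] using h

theorem sqNorm_const_mul (c : ℂ) (w : (Fin d → ℤ) → ℂ) :
    sqNorm (fun n => c * w n) = ENNReal.ofReal (‖c‖ ^ 2) * sqNorm w := by
  unfold sqNorm
  rw [← ENNReal.tsum_mul_left]
  refine tsum_congr fun n => ?_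
  rw [← ENNReal.ofReal_mul (by positivity), norm_mul, mul_pow]

theorem sqNorm_comp_equiv (e : (Fin d → ℤ) ≃ (Fin d → ℤ)) (w : (Fin d → ℤ) → ℂ) :
    sqNorm (fun n => w (e n)) = sqNorm w :=
  e.tsum_eq fun n => ENNReal.ofReal (‖w n‖ ^ 2)

theorem sqNorm_sum_le {ι : Type*} (s : Finset ι) (w : ι → (Fin d → ℤ) → ℂ) :
    sqNorm (fun n => ∑ i ∈ s, w i n) ≤ s.card * ∑ i ∈ s, sqNorm (w i) := by
  unfold sqNorm
  rw [← Summable.tsum_finsetSum fun _ _ => ENNReal.summable, ← ENNReal.tsum_mul_left]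
  refine ENNReal.tsum_le_tsum fun n => ?_
  rw [← ENNReal.ofReal_sum_of_nonneg fun _ _ => by positivity, ← ENNReal.ofReal_natCast,
    ← ENNReal.ofReal_mul (Nat.cast_nonneg _)]
  refine ENNReal.ofReal_le_ofReal ?_
  calc ‖∑ i ∈ s, w i n‖ ^ 2 ≤ (∑ i ∈ s, ‖w i n‖) ^ 2 := by gcongr; exact norm_sum_le _ _
    _ ≤ _ := sq_sum_le_card_mul_sum_sq

theorem sqNorm_neighbors_le (f g : Fin d → (Fin d → ℤ) → ℂ) {K : ENNReal}
    (hf : ∀ i, sqNorm (f i) ≤ K) (hg : ∀ i, sqNorm (g i) ≤ K) :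
    sqNorm (fun n => ∑ i, (f i n + g i n)) ≤ 4 * d ^ 2 * K := by
  refine (sqNorm_sum_le _ _).trans ?_
  have h : ∀ i ∈ Finset.univ, sqNorm (fun n => f i n + g i n) ≤ 4 * K := by
    intro i _
    calc sqNorm (fun n => f i n + g i n) ≤ 2 * sqNorm (f i) + 2 * sqNorm (g i) := sqNorm_add_le _ _
      _ ≤ 2 * K + 2 * K := by gcongr <;> simp [hf, hg]
      _ = 4 * K := by ring
  calc _ ≤ (Finset.univ : Finset (Fin d)).card * ((Finset.univ : Finset (Fin d)).card • (4 * K)) := by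
        gcongr
        exact Finset.sum_le_card_nsmul _ _ _ h
    _ = 4 * d ^ 2 * K := by
        simp only [Finset.card_univ, Fintype.card_fin, nsmul_eq_mul]
        ring

theorem sqNorm_lap_le (w : (Fin d → ℤ) → ℂ) : sqNorm (lap w) ≤ 4 * d ^ 2 * sqNorm w :=
  sqNorm_neighbors_le (fun i n => w (n + Pi.single i 1)) (fun i n => w (n - Pi.single i 1))
    (fun i => (sqNorm_comp_equiv (Equiv.addRight (Pi.single i 1)) w).le)
    (fun i => (sqNorm_comp_equiv (Equiv.subRight (Pi.single i 1)) w).le)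

/-- A bound for the square of the norm of `Δ - E`. -/
def lapBound (d : ℕ) (E : ℝ) : ENNReal := 2 * (4 * d ^ 2) + 2 * ENNReal.ofReal (E ^ 2)

theorem lapBound_ne_top (d : ℕ) (E : ℝ) : lapBound d E ≠ ⊤ := by
  unfold lapBound
  finiteness

theorem sqNorm_lap_sub_le (E : ℝ) (w : (Fin d → ℤ) → ℂ) :
    sqNorm (fun n => lap w n - E * w n) ≤ lapBound d E * sqNorm w := by
  refine (sqNorm_sub_le _ _).trans ?_
  rw [sqNorm_const_mul, Complex.norm_real, Real.norm_eq_abs, sq_abs]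
  calc _ ≤ 2 * (4 * d ^ 2 * sqNorm w) + 2 * (ENNReal.ofReal (E ^ 2) * sqNorm w) := by
        gcongr
        exact sqNorm_lap_le w
    _ = lapBound d E * sqNorm w := by unfold lapBound; ring

theorem finite_support_lap {w : (Fin d → ℤ) → ℂ} (hw : w.support.Finite) :
    (lap w).support.Finite := by
  have h : (lap w).support ⊆ ⋃ i : Fin d, ((fun n => n + Pi.single i 1) ⁻¹' w.support ∪
      (fun n => n - Pi.single i 1) ⁻¹' w.support) := by
    intro n hn
    by_contra hcon
    simp only [mem_iUnion, mem_union, mem_preimage, Function.mem_support, not_exists, not_or,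
      not_not] at hcon
    exact hn (Finset.sum_eq_zero fun i _ => by rw [(hcon i).1, (hcon i).2, add_zero])
  exact (finite_iUnion fun i => (hw.preimage (add_left_injective _).injOn).union
    (hw.preimage (sub_left_injective).injOn)).subset h

/-! ### Approximate solutions and the spectrum -/

theorem ofReal_norm_sq_eq_tsum (V : (Fin d → ℤ) → OnePoint ℝ) (x : FiniteL2 V) :
    ENNReal.ofReal (‖x‖ ^ 2) = ∑' n, ENNReal.ofReal (‖x n‖ ^ 2) := by
  have h2 : 0 < (2 : ENNReal).toReal := by norm_num
  have h := lp.norm_rpow_eq_tsum h2 x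
  have hs := (memℓp_gen_iff h2).1 (lp.memℓp x)
  simp only [ENNReal.toReal_ofNat, Real.rpow_ofNat] at h hs
  rw [h, ENNReal.ofReal_tsum_of_nonneg (fun _ => by positivity) hs]

theorem memℓp_of_finite_support {ι : Type*} {g : ι → ℂ} (hg : g.support.Finite) : Memℓp g 2 := by
  refine memℓp_gen (summable_of_hasFiniteSupport (hg.subset fun n hn h => hn ?_))
  simp [h]

theorem extendZero_comp_val (V : (Fin d → ℤ) → OnePoint ℝ) {ψ : (Fin d → ℤ) → ℂ}
    (hψ : ∀ n, V n = OnePoint.infty → ψ n = 0) :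
    extendZero V (fun n => ψ n) = ψ := by
  funext n
  unfold extendZero
  split_ifs with h
  · rfl
  · exact (hψ n (not_not.1 h)).symm

/-- Off the spectrum, the squared norm of a finitely supported function is controlled by its defect
in the equation. The defect `r` of `w` is small even at the sites where `V` is large, but `w` need
not vanish where `V = ∞`; the function `w - cos θ · r` does, and
`(H - E) (w - cos θ · r) = sin θ · r - (Δ - E) (cos θ · r)`. -/
theorem exists_sqNorm_le_of_notMem_realSpectrum {V : (Fin d → ℤ) → OnePoint ℝ} {E : ℝ}
    (hE : E ∉ realSpectrum V) :
    ∃ C : ENNReal, C ≠ ⊤ ∧ ∀ θ : (Fin d → ℤ) → ℝ, (∀ n, cotOnePoint (θ n) = V n) →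
      ∀ w : (Fin d → ℤ) → ℂ, w.support.Finite → sqNorm w ≤ C * sqNorm (angleDefect E θ w) := by
  obtain ⟨R, -, hR⟩ : (E : ℂ) ∈ resolventSet (schrodinger V) := not_not.1 hE
  refine ⟨2 * (ENNReal.ofReal (‖R‖ ^ 2) * (2 + 2 * lapBound d E)) + 2, ?_, ?_⟩
  · have := lapBound_ne_top d E
    finiteness
  intro θ hθ w hw
  set r := angleDefect E θ w with hr
  let cr : (Fin d → ℤ) → ℂ := fun n => Real.cos (θ n) * r n
  let ψ : (Fin d → ℤ) → ℂ := fun n => w n - cr n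
  let y : (Fin d → ℤ) → ℂ := fun n => Real.sin (θ n) * r n - (lap cr n - E * cr n)
  have hcr : ∀ n, ‖cr n‖ ≤ ‖r n‖ := by
    intro n
    rw [norm_mul, Complex.norm_real]
    exact mul_le_of_le_one_left (norm_nonneg _) (Real.abs_cos_le_one _)
  have hrs : r.support.Finite := by
    refine (hw.union (finite_support_lap hw)).subset fun n hn => ?_
    by_contra hcon
    simp only [mem_union, Function.mem_support, not_or, not_not] at hcon
    exact hn (by simp [hr, angleDefect, hcon.1, hcon.2])
  have hψs : ψ.support.Finite := by
    refine (hw.union hrs).subset fun n hn => ?_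
    by_contra hcon
    simp only [mem_union, Function.mem_support, not_or, not_not] at hcon
    exact hn (by simp [ψ, cr, hcon.1, hcon.2])
  have hsc : ∀ n, (Real.sin (θ n) : ℂ) ^ 2 + (Real.cos (θ n) : ℂ) ^ 2 = 1 := fun n => by
    exact_mod_cast Real.sin_sq_add_cos_sq (θ n)
  have hψ0 : ∀ n, V n = OnePoint.infty → ψ n = 0 := by
    intro n hn
    have hs : Real.sin (θ n) = 0 := by
      by_contra h
      have := hθ n
      rw [cotOnePoint, if_neg h, hn] at this
      exact OnePoint.coe_ne_infty _ this
    have h1 := hsc n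
    simp only [ψ, cr, hr, angleDefect]
    rw [hs] at h1 ⊢
    simp only [Complex.ofReal_zero] at h1 ⊢
    linear_combination -w n * h1
  have hpre : ∀ g : (Fin d → ℤ) → ℂ, g.support.Finite →
      (Function.support fun n : ↥((infiniteSites V)ᶜ) => g n).Finite := fun g hg =>
    hg.preimage Subtype.val_injective.injOn
  let x : FiniteL2 V := ⟨fun n => ψ n, memℓp_of_finite_support (hpre ψ hψs)⟩
  have hx : x ∈ schrodingerDomain V := by
    refine memℓp_of_finite_support ((hpre ψ hψs).subset fun n hn h => hn ?_)
    change (realValue (V n) : ℂ) * ψ n = 0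
    rw [show ψ n = 0 from h, mul_zero]
  have happ : ∀ n : ↥((infiniteSites V)ᶜ),
      (schrodinger V ⟨x, hx⟩ - (E : ℂ) • x : FiniteL2 V) n = y n := by
    intro n
    have h1 : (schrodinger V ⟨x, hx⟩ - (E : ℂ) • x : FiniteL2 V) n
        = lap (extendZero V fun n => ψ n) n + (realValue (V n) : ℂ) * ψ n - E * ψ n := rfl
    rw [h1, extendZero_comp_val V hψ0]
    have hs : Real.sin (θ n) ≠ 0 := by
      intro h
      have := hθ n
      rw [cotOnePoint, if_pos h] at this
      exact n.2 this.symm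
    have hV : realValue (V n) = Real.cos (θ n) / Real.sin (θ n) := by
      rw [← hθ n, cotOnePoint, if_neg hs]
      rfl
    have hlap : lap ψ n = lap w n - lap cr n := by
      simp only [lap, ψ, ← Finset.sum_sub_distrib]
      exact Finset.sum_congr rfl fun i _ => by ring
    have hs' : (Real.sin (θ n) : ℂ) ≠ 0 := by exact_mod_cast hs
    have hrn : r n = Real.sin (θ n) * (lap w n - E * w n) + Real.cos (θ n) * w n := rfl
    have hcrn : cr n = Real.cos (θ n) * r n := rfl
    rw [hV, hlap]
    simp only [ψ, y]
    rw [Complex.ofReal_div]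
    have h2 : (Real.cos (θ n) : ℂ) / Real.sin (θ n) * (w n - cr n)
        = Real.sin (θ n) * r n - (lap w n - E * w n) := by
      rw [div_mul_eq_mul_div, div_eq_iff hs', hcrn]
      linear_combination (-(r n)) * hsc n - hrn
    linear_combination h2
  have hnorm : ‖x‖ ≤ ‖R‖ * ‖(schrodinger V ⟨x, hx⟩ - (E : ℂ) • x : FiniteL2 V)‖ := by
    have h1 := hR ⟨x, hx⟩
    calc ‖x‖ = ‖R (schrodinger V ⟨x, hx⟩ - (E : ℂ) • x)‖ := by rw [h1]
      _ ≤ _ := R.le_opNorm _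
  have hψx : sqNorm ψ = ENNReal.ofReal (‖x‖ ^ 2) := by
    rw [ofReal_norm_sq_eq_tsum]
    refine (tsum_subtype_eq_of_support_subset
      (f := fun n => ENNReal.ofReal (‖ψ n‖ ^ 2)) (s := (infiniteSites V)ᶜ) fun n hn h => hn ?_).symm
    simp [hψ0 n h]
  have hy : ENNReal.ofReal (‖(schrodinger V ⟨x, hx⟩ - (E : ℂ) • x : FiniteL2 V)‖ ^ 2)
      ≤ sqNorm y := by
    rw [ofReal_norm_sq_eq_tsum]
    simp only [happ]
    exact ENNReal.tsum_comp_le_tsum_of_injective Subtype.val_injective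
      fun n => ENNReal.ofReal (‖y n‖ ^ 2)
  have hyr : sqNorm y ≤ (2 + 2 * lapBound d E) * sqNorm r := by
    calc sqNorm y ≤ 2 * sqNorm (fun n => Real.sin (θ n) * r n)
          + 2 * sqNorm (fun n => lap cr n - E * cr n) := sqNorm_sub_le _ _
      _ ≤ 2 * sqNorm r + 2 * (lapBound d E * sqNorm r) := by
          gcongr
          · refine sqNorm_mono fun n => ?_
            rw [norm_mul, Complex.norm_real]
            exact mul_le_of_le_one_left (norm_nonneg _) (Real.abs_sin_le_one _)
          · exact (sqNorm_lap_sub_le E cr).trans (by gcongr; exact sqNorm_mono hcr)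
      _ = _ := by ring
  have hψr : sqNorm ψ ≤ ENNReal.ofReal (‖R‖ ^ 2) * ((2 + 2 * lapBound d E) * sqNorm r) := by
    rw [hψx]
    calc _ ≤ ENNReal.ofReal
          ((‖R‖ * ‖(schrodinger V ⟨x, hx⟩ - (E : ℂ) • x : FiniteL2 V)‖) ^ 2) := by gcongr
      _ = ENNReal.ofReal (‖R‖ ^ 2) *
          ENNReal.ofReal (‖(schrodinger V ⟨x, hx⟩ - (E : ℂ) • x : FiniteL2 V)‖ ^ 2) := by
          rw [mul_pow, ENNReal.ofReal_mul (by positivity)]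
      _ ≤ _ := by gcongr; exact hy.trans hyr
  calc sqNorm w = sqNorm (fun n => ψ n + cr n) := by simp [ψ]
    _ ≤ 2 * sqNorm ψ + 2 * sqNorm cr := sqNorm_add_le _ _
    _ ≤ 2 * (ENNReal.ofReal (‖R‖ ^ 2) * ((2 + 2 * lapBound d E) * sqNorm r)) + 2 * sqNorm r := by
        gcongr
        exact sqNorm_mono hcr
    _ = _ := by ring

/-! ### Cutting off bounded solutions -/

/-- The box `{-L, …, L}^d`. -/
def box (d : ℕ) (L : ℕ) : Finset (Fin d → ℤ) :=
  Finset.Icc (fun _ => -(L : ℤ)) fun _ => (L : ℤ)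

theorem mem_box {L : ℕ} {n : Fin d → ℤ} : n ∈ box d L ↔ ∀ i, -(L : ℤ) ≤ n i ∧ n i ≤ L := by
  simp [box, Finset.mem_Icc, Pi.le_def, forall_and]

theorem box_mono {L M : ℕ} (h : L ≤ M) : box d L ⊆ box d M := by
  intro n hn
  rw [mem_box] at hn ⊢
  exact fun i => ⟨by have := (hn i).1; omega, by have := (hn i).2; omega⟩

theorem card_box (L : ℕ) : (box d L).card = (2 * L + 1) ^ d := by
  rw [box, Pi.card_Icc]
  simp only [Int.card_Icc, Finset.prod_const, Finset.card_univ, Fintype.card_fin]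
  congr 1
  omega

theorem mem_box_succ_of_near {L : ℕ} {m n : Fin d → ℤ} (hm : m ∈ box d L)
    (h : ∀ i, |n i - m i| ≤ 1) : n ∈ box d (L + 1) := by
  rw [mem_box] at hm ⊢
  intro i
  have h1 := abs_le.1 (h i)
  have h2 := hm i
  push_cast
  constructor <;> linarith [h1.1, h1.2, h2.1, h2.2]

/-- A bounded function has, on some box, a boundary layer that carries a small part of its square
sum: the square sums over boxes grow at most polynomially. -/
theorem exists_small_boundary_layer {ψ : (Fin d → ℤ) → ℂ} (hb : ∀ n, ‖ψ n‖ ≤ 1)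
    (h0 : ‖ψ 0‖ = 1) {ε : ℝ} (hε : 0 < ε) :
    ∃ L, ∑ n ∈ box d (L + 2) \ box d L, ‖ψ n‖ ^ 2 ≤ ε * ∑ n ∈ box d (L + 1), ‖ψ n‖ ^ 2 := by
  by_contra! hcon
  let S : ℕ → ℝ := fun L => ∑ n ∈ box d L, ‖ψ n‖ ^ 2
  have hS : ∀ L, S (L + 2) = (∑ n ∈ box d (L + 2) \ box d L, ‖ψ n‖ ^ 2) + S L := fun L =>
    (Finset.sum_sdiff (box_mono (by omega))).symm
  have hSmono : ∀ L, S L ≤ S (L + 1) := fun L =>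
    Finset.sum_le_sum_of_subset_of_nonneg (box_mono (by omega)) fun _ _ _ => by positivity
  have hgrow : ∀ j : ℕ, (1 + ε) ^ j ≤ S (2 * j) := by
    intro j
    induction j with
    | zero =>
      have h1 : (0 : Fin d → ℤ) ∈ box d 0 := by simp [mem_box]
      have h2 := Finset.single_le_sum (f := fun n => ‖ψ n‖ ^ 2) (fun _ _ => by positivity) h1
      simpa [h0] using h2
    | succ j ih =>
      have h1 := hcon (2 * j)
      have h2 := hS (2 * j)
      have h3 : ε * S (2 * j) ≤ ε * S (2 * j + 1) := by gcongr; exact hSmono _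
      rw [show 2 * (j + 1) = 2 * j + 2 by ring, pow_succ]
      calc (1 + ε) ^ j * (1 + ε) ≤ S (2 * j) * (1 + ε) := by gcongr
        _ = S (2 * j) + ε * S (2 * j) := by ring
        _ ≤ S (2 * j + 2) := by rw [h2]; change ε * S (2 * j + 1) < _ at h1; linarith
  have hpoly : ∀ j : ℕ, 1 ≤ j → S (2 * j) ≤ 5 ^ d * (j : ℝ) ^ d := by
    intro j hj
    calc S (2 * j) ≤ ∑ n ∈ box d (2 * j), (1 : ℝ) :=
          Finset.sum_le_sum fun n _ => pow_le_one₀ (norm_nonneg _) (hb n)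
      _ = ((2 * (2 * j) + 1 : ℕ) : ℝ) ^ d := by simp [card_box]
      _ ≤ (5 * (j : ℝ)) ^ d := by
          gcongr
          push_cast
          have : (1 : ℝ) ≤ j := by exact_mod_cast hj
          linarith
      _ = _ := mul_pow _ _ _
  have hlim := (tendsto_pow_const_div_const_pow_of_one_lt d (show 1 < 1 + ε by linarith)).const_mul
    ((5 : ℝ) ^ d)
  rw [mul_zero] at hlim
  obtain ⟨j, hj1, hj⟩ := ((eventually_ge_atTop 1).and
    (hlim.eventually (gt_mem_nhds (zero_lt_one (α := ℝ))))).exists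
  have h1 := (hgrow j).trans (hpoly j hj1)
  have h2 : (0 : ℝ) < (1 + ε) ^ j := by positivity
  rw [← mul_div_assoc, div_lt_one h2] at hj
  linarith

theorem sqNorm_ite_mem (s : Finset (Fin d → ℤ)) (ψ : (Fin d → ℤ) → ℂ) :
    sqNorm (fun n => if n ∈ s then ψ n else 0) = ENNReal.ofReal (∑ n ∈ s, ‖ψ n‖ ^ 2) := by
  unfold sqNorm
  rw [tsum_eq_sum (s := s) fun n hn => by simp [hn],
    ENNReal.ofReal_sum_of_nonneg fun _ _ => by positivity]
  exact Finset.sum_congr rfl fun n hn => by simp [hn]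

/-- Multiplying a bounded solution by the indicator function of a suitable box gives a finitely
supported approximate solution. -/
theorem exists_approximate_solution {E : ℝ} {θ : (Fin d → ℤ) → ℝ} {ψ : (Fin d → ℤ) → ℂ}
    (hb : ∀ n, ‖ψ n‖ ≤ 1) (h0 : ‖ψ 0‖ = 1) (hψ : ∀ n, angleDefect E θ ψ n = 0)
    {ε : ℝ} (hε : 0 < ε) :
    ∃ w : (Fin d → ℤ) → ℂ, w.support.Finite ∧ sqNorm w ≠ 0 ∧ sqNorm w ≠ ⊤ ∧
      sqNorm (angleDefect E θ w) ≤ ENNReal.ofReal ε * sqNorm w := by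
  have hε' : 0 < ε / (4 * d ^ 2 + 1) := by positivity
  obtain ⟨L, hL⟩ := exists_small_boundary_layer hb h0 hε'
  let w : (Fin d → ℤ) → ℂ := fun n => if n ∈ box d (L + 1) then ψ n else 0
  have hw : sqNorm w = ENNReal.ofReal (∑ n ∈ box d (L + 1), ‖ψ n‖ ^ 2) := sqNorm_ite_mem _ _
  have hpos : 0 < ∑ n ∈ box d (L + 1), ‖ψ n‖ ^ 2 := by
    refine Finset.sum_pos' (fun _ _ => by positivity) ⟨0, ?_, by simp [h0]⟩
    rw [mem_box]
    intro i
    constructor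
    · simp only [Pi.zero_apply]; omega
    · simp only [Pi.zero_apply]; omega
  refine ⟨w, (box d (L + 1)).finite_toSet.subset fun n hn => ?_, ?_, ?_, ?_⟩
  · by_contra h
    exact hn (if_neg h)
  · rw [hw]
    simpa using hpos
  · rw [hw]
    exact ENNReal.ofReal_ne_top
  -- The defect of `w` only involves bonds that cross the boundary of the box.
  let χ : (Fin d → ℤ) → ℂ := fun n => if n ∈ box d (L + 1) then 1 else 0
  have hwχ : ∀ n, w n = χ n * ψ n := fun n => by simp [w, χ]
  let layer : (Fin d → ℤ) → ℂ := fun n => if n ∈ box d (L + 2) \ box d L then ψ n else 0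
  have hdiff : ∀ m n : Fin d → ℤ, (∀ i, |n i - m i| ≤ 1) →
      ‖(χ m - χ n) * ψ m‖ ≤ ‖layer m‖ := by
    intro m n hmn
    have hnm : ∀ i, |m i - n i| ≤ 1 := fun i => by rw [abs_sub_comm]; exact hmn i
    by_cases hm : m ∈ box d (L + 2) \ box d L
    · have h1 : ‖χ m - χ n‖ ≤ 1 := by
        simp only [χ]
        split_ifs <;> simp
      simp only [layer, if_pos hm, norm_mul]
      exact mul_le_of_le_one_left (norm_nonneg _) h1
    · have h1 : χ m = χ n := by
        rw [Finset.mem_sdiff, not_and_or, not_not] at hm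
        rcases hm with hm | hm
        · have h2 : m ∉ box d (L + 1) := fun h => hm (box_mono (by omega) h)
          have h3 : n ∉ box d (L + 1) := fun h => hm (mem_box_succ_of_near h hnm)
          simp [χ, h2, h3]
        · have h2 : m ∈ box d (L + 1) := box_mono (by omega) hm
          have h3 : n ∈ box d (L + 1) := mem_box_succ_of_near hm hmn
          simp [χ, h2, h3]
      simp [h1]
  have hnear : ∀ i j : Fin d, |(Pi.single i 1 : Fin d → ℤ) j| ≤ 1 := by
    intro i j
    rw [Pi.single_apply]
    split_ifs <;> simp
  let f : Fin d → (Fin d → ℤ) → ℂ := fun i n =>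
    (χ (n + Pi.single i 1) - χ n) * ψ (n + Pi.single i 1)
  let g : Fin d → (Fin d → ℤ) → ℂ := fun i n =>
    (χ (n - Pi.single i 1) - χ n) * ψ (n - Pi.single i 1)
  have hf : ∀ i, sqNorm (f i) ≤ sqNorm layer := fun i => by
    rw [← sqNorm_comp_equiv (Equiv.addRight (Pi.single i 1)) layer]
    exact sqNorm_mono fun n => hdiff _ _ fun j => by simpa using hnear i j
  have hg : ∀ i, sqNorm (g i) ≤ sqNorm layer := fun i => by
    rw [← sqNorm_comp_equiv (Equiv.subRight (Pi.single i 1)) layer]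
    exact sqNorm_mono fun n => hdiff _ _ fun j => by simpa using hnear i j
  have hdef : ∀ n, angleDefect E θ w n = Real.sin (θ n) * ∑ i, (f i n + g i n) := by
    intro n
    have h1 : ∑ i, (f i n + g i n) = lap w n - χ n * lap ψ n := by
      simp only [lap, f, g, hwχ, Finset.mul_sum, ← Finset.sum_sub_distrib]
      exact Finset.sum_congr rfl fun i _ => by ring
    have h2 := hψ n
    simp only [angleDefect] at h2 ⊢
    rw [h1, hwχ n]
    linear_combination χ n * h2
  calc sqNorm (angleDefect E θ w) ≤ sqNorm (fun n => ∑ i, (f i n + g i n)) := by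
        refine sqNorm_mono fun n => ?_
        rw [hdef, norm_mul, Complex.norm_real]
        exact mul_le_of_le_one_left (norm_nonneg _) (Real.abs_sin_le_one _)
    _ ≤ 4 * d ^ 2 * sqNorm layer := sqNorm_neighbors_le f g hf hg
    _ ≤ ENNReal.ofReal (4 * d ^ 2) * ENNReal.ofReal (ε / (4 * d ^ 2 + 1) *
        ∑ n ∈ box d (L + 1), ‖ψ n‖ ^ 2) := by
        rw [sqNorm_ite_mem]
        gcongr
        rw [ENNReal.ofReal_mul (by norm_num), ENNReal.ofReal_pow (by positivity)]
        simp
    _ ≤ ENNReal.ofReal ε * sqNorm w := by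
        rw [hw, ← ENNReal.ofReal_mul (by positivity), ← ENNReal.ofReal_mul hε.le, ← mul_assoc]
        gcongr
        rw [mul_div_assoc', div_le_iff₀ (by positivity)]
        nlinarith

/-! ### Local limits of translates -/

theorem exists_pos_mul_ofReal_le {K : ENNReal} (hK : K ≠ ⊤) :
    ∃ ε : ℝ, 0 < ε ∧ ε ≤ 1 ∧ K * ENNReal.ofReal ε ≤ ENNReal.ofReal (1 / 4) := by
  have hk : 0 ≤ K.toReal := ENNReal.toReal_nonneg
  refine ⟨1 / (4 * (K.toReal + 1)), by positivity, ?_, ?_⟩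
  · rw [div_le_one (by positivity)]
    linarith
  · rw [← ENNReal.ofReal_toReal hK, ← ENNReal.ofReal_mul hk]
    refine ENNReal.ofReal_le_ofReal ?_
    rw [mul_one_div, ENNReal.ofReal_toReal hK, div_le_div_iff₀ (by positivity) (by positivity)]
    linarith

theorem lap_comp_sub (w : (Fin d → ℤ) → ℂ) (m n : Fin d → ℤ) :
    lap (fun k => w (k - m)) (n + m) = lap w n := by
  refine Finset.sum_congr rfl fun i _ => ?_
  beta_reduce
  rw [show n + m + Pi.single i 1 - m = n + Pi.single i 1 by abel,
    show n + m - Pi.single i 1 - m = n - Pi.single i 1 by abel]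

/-- An energy with a bounded solution for a potential that is locally a limit of translates of `V`
belongs to the spectrum of `Δ + V`. -/
theorem mem_realSpectrum_of_local_limit {V : (Fin d → ℤ) → OnePoint ℝ} {E : ℝ}
    {θ : (Fin d → ℤ) → ℝ} {ψ : (Fin d → ℤ) → ℂ} (hb : ∀ n, ‖ψ n‖ ≤ 1) (h0 : ‖ψ 0‖ = 1)
    (hψ : ∀ n, angleDefect E θ ψ n = 0) {θ' : (Fin d → ℤ) → ℝ}
    (hθ' : ∀ n, cotOnePoint (θ' n) = V n)
    (hlim : ∀ (S : Finset (Fin d → ℤ)) (δ : ℝ), 0 < δ →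
      ∃ m : Fin d → ℤ, ∀ n ∈ S, |θ' (n + m) - θ n| ≤ δ) :
    E ∈ realSpectrum V := by
  by_contra hE
  obtain ⟨C, hC, hCw⟩ := exists_sqNorm_le_of_notMem_realSpectrum hE
  have hB := lapBound_ne_top d E
  obtain ⟨ε, hε, -, hεC⟩ := exists_pos_mul_ofReal_le (K := C * 2) (by finiteness)
  obtain ⟨δ, hδ, hδ1, hδC⟩ := exists_pos_mul_ofReal_le
    (K := C * (2 * (2 * lapBound d E + 2))) (by finiteness)
  obtain ⟨w, hws, hw0, hwt, hwε⟩ := exists_approximate_solution hb h0 hψ hε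
  obtain ⟨m, hm⟩ := hlim (hws.union (finite_support_lap hws)).toFinset δ hδ
  let w' : (Fin d → ℤ) → ℂ := fun n => w (n - m)
  have hw'Q : sqNorm w' = sqNorm w := sqNorm_comp_equiv (Equiv.subRight m) w
  have hw's : w'.support.Finite := hws.preimage (sub_left_injective).injOn
  let T : (Fin d → ℤ) → ℂ := fun n => lap w n - E * w n
  let D : (Fin d → ℤ) → ℂ := fun n => δ * (‖T n‖ + ‖w n‖ : ℝ)
  have hD : sqNorm D ≤ ENNReal.ofReal δ * ((2 * lapBound d E + 2) * sqNorm w) := by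
    rw [sqNorm_const_mul]
    have h1 : ENNReal.ofReal (‖(δ : ℂ)‖ ^ 2) ≤ ENNReal.ofReal δ := by
      refine ENNReal.ofReal_le_ofReal ?_
      rw [Complex.norm_real, Real.norm_eq_abs, sq_abs]
      nlinarith
    have h2 : sqNorm (fun n => ((‖T n‖ + ‖w n‖ : ℝ) : ℂ)) ≤ (2 * lapBound d E + 2) * sqNorm w := by
      have h3 := sqNorm_add_le (fun n => ((‖T n‖ : ℝ) : ℂ)) fun n => ((‖w n‖ : ℝ) : ℂ)
      have h4 : sqNorm (fun n => ((‖T n‖ : ℝ) : ℂ)) = sqNorm T := by simp [sqNorm]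
      have h5 : sqNorm (fun n => ((‖w n‖ : ℝ) : ℂ)) = sqNorm w := by simp [sqNorm]
      rw [h4, h5] at h3
      push_cast
      refine h3.trans ?_
      calc 2 * sqNorm T + 2 * sqNorm w ≤ 2 * (lapBound d E * sqNorm w) + 2 * sqNorm w := by
            gcongr
            exact sqNorm_lap_sub_le E w
        _ = _ := by ring
    gcongr
  have hdef : sqNorm (angleDefect E θ' w')
      ≤ 2 * sqNorm (angleDefect E θ w) + 2 * sqNorm D := by
    rw [← sqNorm_comp_equiv (Equiv.addRight m) (angleDefect E θ' w')]
    let r : (Fin d → ℤ) → ℂ := fun n => angleDefect E θ' w' (n + m) - angleDefect E θ w n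
    have hr : sqNorm r ≤ sqNorm D := by
      refine sqNorm_mono fun n => ?_
      have h1 : r n = ((Real.sin (θ' (n + m)) - Real.sin (θ n) : ℝ) : ℂ) * T n
          + ((Real.cos (θ' (n + m)) - Real.cos (θ n) : ℝ) : ℂ) * w n := by
        simp only [r, angleDefect, w', lap_comp_sub, add_sub_cancel_right, T]
        push_cast
        ring
      have h2 : ‖D n‖ = δ * (‖T n‖ + ‖w n‖) := by
        simp only [D]
        rw [norm_mul, Complex.norm_real, Complex.norm_real, Real.norm_eq_abs, Real.norm_eq_abs,
          abs_of_pos hδ, abs_of_nonneg (by positivity)]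
      rw [h2]
      by_cases hn : n ∈ (hws.union (finite_support_lap hws)).toFinset
      · have h3 := hm n hn
        have h4 : |Real.sin (θ' (n + m)) - Real.sin (θ n)| ≤ δ :=
          (by simpa [Real.dist_eq] using Real.lipschitzWith_sin.dist_le_mul (θ' (n + m)) (θ n) :
            |Real.sin (θ' (n + m)) - Real.sin (θ n)| ≤ |θ' (n + m) - θ n|).trans h3
        have h5 : |Real.cos (θ' (n + m)) - Real.cos (θ n)| ≤ δ :=
          (by simpa [Real.dist_eq] using Real.lipschitzWith_cos.dist_le_mul (θ' (n + m)) (θ n) :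
            |Real.cos (θ' (n + m)) - Real.cos (θ n)| ≤ |θ' (n + m) - θ n|).trans h3
        rw [h1, mul_add]
        refine (norm_add_le _ _).trans ?_
        rw [norm_mul, norm_mul, Complex.norm_real, Complex.norm_real]
        gcongr <;> assumption
      · simp only [Finite.mem_toFinset, mem_union, Function.mem_support, not_or, not_not] at hn
        have h3 : r n = 0 := by
          rw [h1]
          simp [T, hn.1, hn.2]
        rw [h3, norm_zero]
        positivity
    have h2 := sqNorm_add_le (angleDefect E θ w) r
    have h3 : (fun n => angleDefect E θ w n + r n)
        = fun n => angleDefect E θ' w' (Equiv.addRight m n) := by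
      funext n
      simp [r]
    rw [h3] at h2
    exact h2.trans (by gcongr)
  have hfin : sqNorm w ≤ ENNReal.ofReal (1 / 2) * sqNorm w := by
    calc sqNorm w = sqNorm w' := hw'Q.symm
      _ ≤ C * sqNorm (angleDefect E θ' w') := hCw θ' hθ' w' hw's
      _ ≤ C * (2 * (ENNReal.ofReal ε * sqNorm w)
          + 2 * (ENNReal.ofReal δ * ((2 * lapBound d E + 2) * sqNorm w))) := by
          gcongr
          exact hdef.trans (by gcongr)
      _ = (C * 2 * ENNReal.ofReal ε
          + C * (2 * (2 * lapBound d E + 2)) * ENNReal.ofReal δ) * sqNorm w := by ring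
      _ ≤ (ENNReal.ofReal (1 / 4) + ENNReal.ofReal (1 / 4)) * sqNorm w := by gcongr
      _ = ENNReal.ofReal (1 / 2) * sqNorm w := by
          rw [← ENNReal.ofReal_add (by norm_num) (by norm_num)]
          norm_num
  have h1 : ENNReal.ofReal (1 / 2) * sqNorm w < 1 * sqNorm w := by
    refine ENNReal.mul_lt_mul_left hw0 hwt ?_
    rw [← ENNReal.ofReal_one]
    exact (ENNReal.ofReal_lt_ofReal_iff one_pos).2 (by norm_num)
  rw [one_mul] at h1
  exact absurd hfin (not_le.2 h1)

/-! ### Rational approximation of the frequencies -/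

/-- Simultaneous rational approximation by `ℚ`-linear functionals that fix `1`. Linearity is needed
so that every relation `n · α ∈ ℤ` between the frequencies persists for the approximations. -/
theorem exists_rational_functionals :
    ∃ lam : ℕ → ℝ →ₗ[ℚ] ℚ, (∀ k, lam k 1 = 1) ∧
      ∀ v : ℝ, Tendsto (fun k => ((lam k v : ℚ) : ℝ)) atTop (𝓝 v) := by
  have hs : LinearIndepOn ℚ id ({1} : Set ℝ) := (linearIndepOn_singleton_iff ℚ).2 one_ne_zero
  let b := Module.Basis.extend hs
  have hb : ∀ i, b i = (i : ℝ) := Module.Basis.extend_apply_self hs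
  let c : ℕ → hs.extend (subset_univ _) → ℚ := fun k i =>
    (⌊((k : ℝ) + 1) * (i : ℝ)⌋ : ℚ) / ((k : ℚ) + 1)
  have hc : ∀ i, Tendsto (fun k => ((c k i : ℚ) : ℝ)) atTop (𝓝 (i : ℝ)) := by
    intro i
    have h1 : Tendsto (fun k : ℕ => (i : ℝ) - 1 / ((k : ℝ) + 1)) atTop (𝓝 (i : ℝ)) := by
      simpa using (tendsto_one_div_add_atTop_nhds_zero_nat (𝕜 := ℝ)).const_sub (i : ℝ)
    refine tendsto_of_tendsto_of_tendsto_of_le_of_le h1 tendsto_const_nhds (fun k => ?_) fun k => ?_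
    · have hk : (0 : ℝ) < (k : ℝ) + 1 := by positivity
      have := Int.sub_one_lt_floor (((k : ℝ) + 1) * (i : ℝ))
      simp only [c]
      push_cast
      rw [le_div_iff₀ hk, sub_mul, one_div_mul_cancel hk.ne']
      linarith
    · have hk : (0 : ℝ) < (k : ℝ) + 1 := by positivity
      have := Int.floor_le (((k : ℝ) + 1) * (i : ℝ))
      simp only [c]
      push_cast
      rw [div_le_iff₀ hk]
      linarith
  refine ⟨fun k => b.constr ℚ (c k), fun k => ?_, fun v => ?_⟩
  · have h1 : (1 : ℝ) ∈ hs.extend (subset_univ _) := hs.subset_extend _ (mem_singleton 1)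
    have h2 : b ⟨1, h1⟩ = 1 := hb _
    have h3 : b.constr ℚ (c k) (b ⟨1, h1⟩) = c k ⟨1, h1⟩ := b.constr_basis ℚ (c k) _
    rw [h2] at h3
    rw [h3]
    simp only [c, mul_one]
    have h4 : ⌊(k : ℝ) + 1⌋ = (k : ℤ) + 1 := by
      rw [show (k : ℝ) + 1 = (((k : ℤ) + 1 : ℤ) : ℝ) by push_cast; rfl, Int.floor_intCast]
    rw [h4]
    push_cast
    exact div_self (by positivity)
  · have hv : ∑ i ∈ (b.repr v).support, ((b.repr v i : ℚ) : ℝ) * (i : ℝ) = v := by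
      conv_rhs => rw [← b.linearCombination_repr v]
      rw [Finsupp.linearCombination_apply, Finsupp.sum]
      exact Finset.sum_congr rfl fun i _ => by rw [hb, Rat.smul_def]
    have h1 : ∀ k, ((b.constr ℚ (c k) v : ℚ) : ℝ)
        = ∑ i ∈ (b.repr v).support, ((b.repr v i : ℚ) : ℝ) * ((c k i : ℚ) : ℝ) := by
      intro k
      rw [Module.Basis.constr_apply, Finsupp.sum]
      push_cast [smul_eq_mul]
      rfl
    simp only [h1]
    conv => rhs; rw [← hv]
    exact tendsto_finsetSum _ fun i _ => (hc i).const_mul _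

/-- The phase `n · α`. -/
def phase (α : Fin d → ℝ) (n : Fin d → ℤ) : ℝ := ∑ i, (n i : ℝ) * α i

theorem phase_add (α : Fin d → ℝ) (m n : Fin d → ℤ) : phase α (m + n) = phase α m + phase α n := by
  simp [phase, add_mul, Finset.sum_add_distrib]

theorem phase_neg (α : Fin d → ℝ) (n : Fin d → ℤ) : phase α (-n) = -phase α n := by
  simp [phase]

/-! ### Inserting the arc -/

/-- On `[0, 1]`, runs quickly through the interval `[-1, 0]` and then follows the identity. Composed
with the function on `[-1, 1]` that is glued from an arc and `f`, it gives a continuous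
modification of `f` in a short interval to the right of `0`. -/
def insertArc (k : ℕ) (r : ℝ) : ℝ := min (((k : ℝ) + 2) * r - 1) r

/-- The lift of `insertArc` to the line, with `squeeze k (x + 1) = squeeze k x + 2`. -/
def squeeze (k : ℕ) (x : ℝ) : ℝ := insertArc k (Int.fract x) + 2 * ⌊x⌋

theorem continuous_squeeze (k : ℕ) : Continuous (squeeze k) := by
  have h1 : Continuous ((fun r => insertArc k r - 2 * r) ∘ Int.fract : ℝ → ℝ) := by
    refine ContinuousOn.comp_fract'' ?_ ?_
    · unfold insertArc
      fun_prop
    · have h : (1 : ℝ) ≤ k + 2 - 1 := by linarith [(Nat.cast_nonneg k : (0 : ℝ) ≤ k)]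
      norm_num [insertArc, min_eq_right h]
  have h2 : squeeze k = fun x => ((fun r => insertArc k r - 2 * r) ∘ Int.fract : ℝ → ℝ) x + 2 * x := by
    funext x
    simp only [squeeze, Function.comp_apply]
    linear_combination 2 * Int.fract_add_floor x
  rw [h2]
  fun_prop

theorem squeeze_add_one (k : ℕ) (x : ℝ) : squeeze k (x + 1) = squeeze k x + 2 := by
  simp only [squeeze, Int.fract_add_one, Int.floor_add_one]
  push_cast
  ring

theorem insertArc_mem_Icc (k : ℕ) (x : ℝ) : insertArc k (Int.fract x) ∈ Icc (-1 : ℝ) 1 := by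
  have h0 := Int.fract_nonneg x
  have h1 := (Int.fract_lt_one x).le
  have h2 : (0 : ℝ) ≤ ((k : ℝ) + 2) * Int.fract x := by positivity
  exact ⟨le_min (by linarith) (by linarith), (min_le_right _ _).trans h1⟩

theorem insertArc_eq_self {k : ℕ} {r : ℝ} (h : 1 ≤ ((k : ℝ) + 1) * r) : insertArc k r = r :=
  min_eq_right (by linarith)

/-- The angle at the phase `x` when the angle at integers is `Θ s`. -/
def hullAngle (Θ : ℝ → ℝ) (s x : ℝ) : ℝ := if Int.fract x = 0 then Θ s else Θ (Int.fract x)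

theorem hullAngle_add_intCast (Θ : ℝ → ℝ) (s x : ℝ) (j : ℤ) :
    hullAngle Θ s (x + j) = hullAngle Θ s x := by
  simp [hullAngle]

theorem continuousAt_fract_of_ne {x : ℝ} (hx : Int.fract x ≠ 0) : ContinuousAt Int.fract x :=
  continuousAt_fract fun h => hx (by rw [Int.fract, ← h, sub_self])

theorem continuousAt_hullAngle {Θ : ℝ → ℝ} (hΘ : Continuous Θ) (s : ℝ) {x : ℝ}
    (hx : Int.fract x ≠ 0) : ContinuousAt (hullAngle Θ s) x := by
  have h1 := continuousAt_fract_of_ne hx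
  refine (hΘ.continuousAt.comp h1).congr ?_
  filter_upwards [h1.eventually_ne hx] with z hz
  simp [hullAngle, hz]

theorem exists_tendsto_ultrafilter {X : Type*} [TopologicalSpace X] (𝒰 : Ultrafilter ℕ) {K : Set X}
    (hK : IsCompact K) {f : ℕ → X} (hf : ∀ k, f k ∈ K) : ∃ x ∈ K, Tendsto f 𝒰 (𝓝 x) :=
  hK.ultrafilter_le_nhds (𝒰.map f)
    (le_principal_iff.2 (Eventually.of_forall (f := (𝒰 : Filter ℕ)) hf))

/-- A limit of phases approaching `0` modulo `1` is sent by `insertArc` to the inserted arc, or to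
the endpoint `1`. -/
theorem limit_insertArc_near_int {𝒰 : Ultrafilter ℕ} (h𝒰 : (𝒰 : Filter ℕ) ≤ atTop) {x : ℕ → ℝ}
    {z : ℝ} (hz : Int.fract z = 0) (hx : Tendsto x 𝒰 (𝓝 z)) {h : ℝ}
    (hh : Tendsto (fun k => insertArc k (Int.fract (x k))) 𝒰 (𝓝 h)) :
    h ∈ Icc (-1 : ℝ) 0 ∨ h = 1 := by
  have hI : h ∈ Icc (-1 : ℝ) 1 :=
    isClosed_Icc.mem_of_tendsto hh (Eventually.of_forall fun k => insertArc_mem_Icc k _)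
  by_contra hcon
  rw [not_or, mem_Icc, not_and, not_le] at hcon
  have h0 : 0 < h := hcon.1 hI.1
  have h1 : h < 1 := lt_of_le_of_ne hI.2 hcon.2
  obtain ⟨j, hj⟩ : ∃ j : ℤ, z = j := ⟨⌊z⌋, by linarith [Int.fract_add_floor z]⟩
  have hlarge : ∀ᶠ k : ℕ in (𝒰 : Filter ℕ), 1 ≤ ((k : ℝ) + 1) * (h / 2) := by
    have : Tendsto (fun k : ℕ => ((k : ℝ) + 1) * (h / 2)) atTop atTop :=
      (tendsto_atTop_add_const_right _ _ tendsto_natCast_atTop_atTop).atTop_mul_const (by linarith)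
    exact h𝒰 (this.eventually_ge_atTop 1)
  have hm : 0 < min (h / 2) ((1 - h) / 2) := lt_min (by linarith) (by linarith)
  obtain ⟨k, hk1, hk2, hk3, hk4⟩ := (hlarge.and
    ((hh.eventually (lt_mem_nhds (show h / 2 < h by linarith))).and
    ((hh.eventually (gt_mem_nhds (show h < (1 + h) / 2 by linarith))).and
    (Metric.tendsto_nhds.1 hx _ hm)))).exists
  rw [Real.dist_eq, hj] at hk4
  have hr : insertArc k (Int.fract (x k)) = Int.fract (x k) := by
    apply insertArc_eq_self
    have h2 : insertArc k (Int.fract (x k)) ≤ Int.fract (x k) := min_le_right _ _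
    have h3 : h / 2 ≤ Int.fract (x k) := by linarith
    calc (1 : ℝ) ≤ ((k : ℝ) + 1) * (h / 2) := hk1
      _ ≤ _ := by gcongr
  rw [hr] at hk2 hk3
  have hfl := Int.fract_add_floor (x k)
  have h5 := abs_lt.1 (hk4.trans_le (min_le_left _ _))
  have h6 := abs_lt.1 (hk4.trans_le (min_le_right _ _))
  rcases lt_trichotomy ⌊x k⌋ j with hlt | heq | hgt
  · have : ((⌊x k⌋ : ℤ) : ℝ) + 1 ≤ j := by exact_mod_cast hlt
    linarith [h6.1]
  · rw [heq] at hfl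
    linarith [h5.2]
  · have : (j : ℝ) + 1 ≤ (⌊x k⌋ : ℤ) := by exact_mod_cast hgt
    linarith [h5.2]

/-! ### Bounded solutions in the quasiperiodic family -/

/-- Every energy admits a bounded solution for some quasiperiodic potential in the hull, with some
point of the arc inserted at the discontinuity. It is a limit of periodic solutions for rational
frequencies and continuous phase functions. -/
theorem exists_bounded_solution (α : Fin d → ℝ) {Θ : ℝ → ℝ} (hΘ : Continuous Θ) {D : ℤ}
    (hD : D ≠ 0) (hper : ∀ y, Θ (y + 2) = Θ y + D * Real.pi) (E : ℝ) :
    ∃ (y s : ℝ) (ψ : (Fin d → ℤ) → ℂ), (s ∈ Icc (-1 : ℝ) 0 ∨ s = 1) ∧ (∀ n, ‖ψ n‖ ≤ 1) ∧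
      ‖ψ 0‖ = 1 ∧ ∀ n, angleDefect E (fun n => hullAngle Θ s (y + phase α n)) ψ n = 0 := by
  obtain ⟨lam, hlam1, hlam⟩ := exists_rational_functionals
  have hlamZ : ∀ k (j : ℤ), lam k (j : ℝ) = j := fun k j => by
    have h := (lam k).map_smul (j : ℚ) 1
    rw [hlam1] at h
    simpa [Rat.smul_def] using h
  have hperΦ : ∀ k x, (Θ ∘ squeeze k) (x + 1) = (Θ ∘ squeeze k) x + D * Real.pi := fun k x => by
    simp only [Function.comp_apply, squeeze_add_one, hper]
  choose X ψ hψb hψ0 hψ using fun k => exists_periodic_solution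
    (hΘ.comp (continuous_squeeze k)) hD (hperΦ k) (fun i => lam k (α i)) E
  have hphase : ∀ k (n : Fin d → ℤ),
      ∑ i, (n i : ℝ) * ((lam k (α i) : ℚ) : ℝ) = ((lam k (phase α n) : ℚ) : ℝ) := by
    intro k n
    have h1 : phase α n = ∑ i, (n i : ℚ) • α i := by
      simp [phase, Rat.smul_def]
    rw [h1, map_sum]
    push_cast [map_smul]
    simp
  let y : ℕ → ℝ := fun k => Int.fract (X k)
  let x : ℕ → (Fin d → ℤ) → ℝ := fun k n => y k + (lam k (phase α n) : ℚ)
  let H : ℕ → (Fin d → ℤ) → ℝ := fun k n => insertArc k (Int.fract (x k n))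
  have hH : ∀ k n, angleDefect E (fun n => Θ (H k n)) (ψ k) n = 0 := by
    intro k n
    have h1 := hψ k n
    have hfr : Int.fract (X k + ((lam k (phase α n) : ℚ) : ℝ)) = Int.fract (x k n) := by
      simp only [x, y]
      rw [Int.fract_eq_fract]
      exact ⟨⌊X k⌋, by linarith [Int.fract_add_floor (X k)]⟩
    have h2 : ∀ t : ℝ, (Θ ∘ squeeze k) t
        = Θ (insertArc k (Int.fract t)) + (D * ⌊t⌋ : ℤ) * Real.pi := by
      intro t
      have h4 := add_int_mul_pi_of_period (hperΦ k) (Int.fract t) ⌊t⌋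
      rw [Int.fract_add_floor] at h4
      rw [h4]
      simp [squeeze]
    rw [angleDefect_add_int_mul_pi (θ := fun n => Θ (H k n)) (ψ k) n
      (D * ⌊X k + ((lam k (phase α n) : ℚ) : ℝ)⌋)
      (by rw [hphase, h2, hfr])] at h1
    exact (mul_eq_zero.1 h1).resolve_left (zpow_ne_zero _ (by norm_num))
  let 𝒰 : Ultrafilter ℕ := hyperfilter ℕ
  have h𝒰 : (𝒰 : Filter ℕ) ≤ atTop := Nat.hyperfilter_le_atTop
  obtain ⟨yl, -, hyl⟩ := exists_tendsto_ultrafilter 𝒰 (isCompact_Icc (a := (0 : ℝ)) (b := 1))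
    (f := y) fun k => ⟨Int.fract_nonneg _, (Int.fract_lt_one _).le⟩
  choose Hl hHlI hHl using fun n => exists_tendsto_ultrafilter 𝒰
    (isCompact_Icc (a := (-1 : ℝ)) (b := 1)) (f := fun k => H k n) fun k => insertArc_mem_Icc k _
  choose ψl hψlB hψl using fun n => exists_tendsto_ultrafilter 𝒰
    (isCompact_closedBall (0 : ℂ) 1) (f := fun k => ψ k n) fun k => by simpa using hψb k n
  have hxl : ∀ n, Tendsto (fun k => x k n) 𝒰 (𝓝 (yl + phase α n)) := fun n =>
    hyl.add ((hlam _).mono_left h𝒰)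
  have hgen : ∀ n, Int.fract (yl + phase α n) ≠ 0 → Hl n = Int.fract (yl + phase α n) := by
    intro n hn
    have hpos : 0 < Int.fract (yl + phase α n) := lt_of_le_of_ne (Int.fract_nonneg _) hn.symm
    have h1 : Tendsto (fun k => Int.fract (x k n)) 𝒰 (𝓝 (Int.fract (yl + phase α n))) :=
      (continuousAt_fract_of_ne hn).tendsto.comp (hxl n)
    have hlarge : ∀ᶠ k : ℕ in (𝒰 : Filter ℕ),
        1 ≤ ((k : ℝ) + 1) * (Int.fract (yl + phase α n) / 2) := by
      have : Tendsto (fun k : ℕ => ((k : ℝ) + 1) * (Int.fract (yl + phase α n) / 2)) atTop atTop :=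
        (tendsto_atTop_add_const_right _ _ tendsto_natCast_atTop_atTop).atTop_mul_const
          (by linarith)
      exact h𝒰 (this.eventually_ge_atTop 1)
    refine tendsto_nhds_unique (hHl n) (h1.congr' ?_)
    filter_upwards [hlarge, h1.eventually (lt_mem_nhds (half_lt_self hpos))] with k hk1 hk2
    refine (insertArc_eq_self (hk1.trans ?_)).symm
    gcongr
  -- The sites where the limit phase is an integer all see the same point of the arc, because the
  -- rational approximations keep integer relations between the frequencies.
  have hint : ∀ m n, Int.fract (yl + phase α m) = 0 → Int.fract (yl + phase α n) = 0 →
      Hl m = Hl n := by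
    intro m n hm hn
    have h1 : phase α m = phase α n + ((⌊yl + phase α m⌋ - ⌊yl + phase α n⌋ : ℤ) : ℝ) := by
      push_cast
      linarith [Int.fract_add_floor (yl + phase α m), Int.fract_add_floor (yl + phase α n)]
    refine tendsto_nhds_unique (hHl m) ((hHl n).congr fun k => ?_)
    simp only [H, x]
    rw [h1, map_add, hlamZ]
    push_cast
    rw [← add_assoc, ← Int.cast_sub, Int.fract_add_intCast]
  obtain ⟨s, hs, hsH⟩ : ∃ s, (s ∈ Icc (-1 : ℝ) 0 ∨ s = 1) ∧
      ∀ n, Int.fract (yl + phase α n) = 0 → Hl n = s := by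
    by_cases hex : ∃ m, Int.fract (yl + phase α m) = 0
    · obtain ⟨m, hm⟩ := hex
      exact ⟨Hl m, limit_insertArc_near_int h𝒰 hm (hxl m) (hHl m), fun n hn => hint n m hn hm⟩
    · exact ⟨0, Or.inl (by simp), fun n hn => absurd ⟨n, hn⟩ hex⟩
  have hΘH : ∀ n, Θ (Hl n) = hullAngle Θ s (yl + phase α n) := by
    intro n
    unfold hullAngle
    split_ifs with h
    · rw [hsH n h]
    · rw [hgen n h]
  refine ⟨yl, s, ψl, hs, fun n => by simpa using hψlB n, ?_, fun n => ?_⟩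
  · exact tendsto_nhds_unique (hψl 0).norm (by simp [hψ0])
  · have hlap : Tendsto (fun k => lap (ψ k) n) 𝒰 (𝓝 (lap ψl n)) :=
      tendsto_finsetSum _ fun i _ => (hψl _).add (hψl _)
    have hθ : Tendsto (fun k => Θ (H k n)) 𝒰 (𝓝 (hullAngle Θ s (yl + phase α n))) := by
      rw [← hΘH]
      exact (hΘ.tendsto _).comp (hHl n)
    have hsin := (Complex.continuous_ofReal.tendsto _).comp ((Real.continuous_sin.tendsto _).comp hθ)
    have hcos := (Complex.continuous_ofReal.tendsto _).comp ((Real.continuous_cos.tendsto _).comp hθ)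
    have hlim := (hsin.mul (hlap.sub ((hψl n).const_mul (E : ℂ)))).add (hcos.mul (hψl n))
    exact tendsto_nhds_unique hlim (tendsto_const_nhds.congr fun k => (hH k n).symm)

/-! ### Translates -/

theorem exists_phase_mem {α : Fin d → ℝ} (hα : ∃ i, Irrational (α i)) {U : Set ℝ} {y : ℝ}
    (hU : U ∈ 𝓝 y) : ∃ (m : Fin d → ℤ) (j : ℤ), phase α m + j ∈ U := by
  obtain ⟨i, hi⟩ := hα
  have hdense : Dense (AddSubgroup.closure {α i, 1} : Set ℝ) :=
    dense_addSubgroupClosure_pair_iff.2 (by simpa using hi)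
  obtain ⟨z, hz, hzU⟩ := hdense.inter_nhds_nonempty hU
  obtain ⟨k, j, hkj⟩ := AddSubgroup.mem_closure_pair.1 hz
  refine ⟨Pi.single i k, j, ?_⟩
  have : phase α (Pi.single i k) = k * α i := by
    rw [phase, Finset.sum_eq_single i]
    · simp
    · intro b _ hb
      simp [hb]
    · simp
  rw [this]
  convert hzU using 1
  rw [← hkj]
  simp

/-- Locally, the angles along any orbit of the rotation are limits of translates of the angles along
the orbit of `0`. -/
theorem exists_translate_near {α : Fin d → ℝ} (hα : ∃ i, Irrational (α i)) {Θ : ℝ → ℝ}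
    (hΘ : Continuous Θ) (s y : ℝ) (S : Finset (Fin d → ℤ)) {δ : ℝ} (hδ : 0 < δ) :
    ∃ m : Fin d → ℤ, ∀ n ∈ S,
      |hullAngle Θ s (phase α (n + m)) - hullAngle Θ s (y + phase α n)| ≤ δ := by
  by_cases hex : ∃ n, Int.fract (y + phase α n) = 0
  · obtain ⟨n₀, h0⟩ := hex
    refine ⟨-n₀, fun n _ => ?_⟩
    have h1 : y + phase α n = phase α (n + -n₀) + (⌊y + phase α n₀⌋ : ℤ) := by
      rw [phase_add, phase_neg]
      linarith [Int.fract_add_floor (y + phase α n₀)]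
    rw [h1, hullAngle_add_intCast, sub_self, abs_zero]
    exact hδ.le
  · push Not at hex
    have hU : ∀ᶠ x in 𝓝 y, ∀ n ∈ S,
        |hullAngle Θ s (x + phase α n) - hullAngle Θ s (y + phase α n)| < δ := by
      rw [Finset.eventually_all]
      intro n _
      have h1 : ContinuousAt (fun x => hullAngle Θ s (x + phase α n)) y :=
        ContinuousAt.comp (f := fun x => x + phase α n) (continuousAt_hullAngle hΘ s (hex n))
          (by fun_prop)
      exact Metric.tendsto_nhds.1 h1 δ hδ
    obtain ⟨m, j, hm⟩ := exists_phase_mem hα hU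
    refine ⟨m, fun n hn => ?_⟩
    have h1 : phase α m + j + phase α n = phase α (n + m) + j := by
      rw [phase_add]
      ring
    have h2 := hm n hn
    rw [h1, hullAngle_add_intCast] at h2
    exact h2.le

/-! ### Symmetry and spectrum near large values of the potential -/

theorem summable_norm_sq_extendZero (V : (Fin d → ℤ) → OnePoint ℝ) (x : FiniteL2 V) :
    Summable fun n => ‖extendZero V x n‖ ^ 2 := by
  have h1 := (memℓp_gen_iff (p := 2) (by norm_num)).1 (lp.memℓp x)
  simp only [ENNReal.toReal_ofNat, Real.rpow_ofNat] at h1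
  refine (Function.Injective.summable_iff (Subtype.val_injective (p := (· ∈ (infiniteSites V)ᶜ)))
    ?_).1 (h1.congr fun n => ?_)
  · intro n hn
    have : n ∉ (infiniteSites V)ᶜ := fun h => hn ⟨⟨n, h⟩, rfl⟩
    simp [extendZero, this]
  · have : (n : Fin d → ℤ) ∈ (infiniteSites V)ᶜ := n.2
    simp only [Function.comp_apply, extendZero, dif_pos this]

theorem extendZero_coe (V : (Fin d → ℤ) → OnePoint ℝ) (x : ↥((infiniteSites V)ᶜ) → ℂ)
    (n : ↥((infiniteSites V)ᶜ)) : extendZero V x n = x n := by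
  have : (n : Fin d → ℤ) ∈ (infiniteSites V)ᶜ := n.2
  simp only [extendZero, dif_pos this]

theorem tsum_mul_extendZero (V : (Fin d → ℤ) → OnePoint ℝ) (x : ↥((infiniteSites V)ᶜ) → ℂ)
    (g : (Fin d → ℤ) → ℂ) :
    ∑' n : ↥((infiniteSites V)ᶜ), x n * g n = ∑' n, extendZero V x n * g n := by
  rw [← tsum_subtype_eq_of_support_subset (s := (infiniteSites V)ᶜ)]
  · exact tsum_congr fun n => by rw [extendZero_coe]
  · intro n hn
    by_contra h
    exact hn (by simp only [extendZero, dif_neg h, zero_mul])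

theorem summable_mul_conj {f g : (Fin d → ℤ) → ℂ} (hf : Summable fun n => ‖f n‖ ^ 2)
    (hg : Summable fun n => ‖g n‖ ^ 2) : Summable fun n => f n * (starRingEnd ℂ) (g n) := by
  refine Summable.of_norm_bounded (hf.add hg) fun n => ?_
  rw [norm_mul, Complex.norm_conj]
  nlinarith [sq_nonneg (‖f n‖ - ‖g n‖), sq_nonneg (‖f n‖), sq_nonneg (‖g n‖)]

theorem tsum_mul_conj_lap {f g : (Fin d → ℤ) → ℂ} (hf : Summable fun n => ‖f n‖ ^ 2)
    (hg : Summable fun n => ‖g n‖ ^ 2) :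
    ∑' n, f n * (starRingEnd ℂ) (lap g n) = ∑' n, lap f n * (starRingEnd ℂ) (g n) := by
  have hshift : ∀ {h : (Fin d → ℤ) → ℂ} (e : (Fin d → ℤ) ≃ (Fin d → ℤ)),
      (Summable fun n => ‖h n‖ ^ 2) → Summable fun n => ‖h (e n)‖ ^ 2 := fun e hh =>
    e.summable_iff.2 hh
  have hp : ∀ {f g : (Fin d → ℤ) → ℂ}, (Summable fun n => ‖f n‖ ^ 2) →
      (Summable fun n => ‖g n‖ ^ 2) → ∀ i : Fin d,
      (Summable fun n => f n * (starRingEnd ℂ) (g (n + Pi.single i 1))) ∧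
      Summable fun n => f n * (starRingEnd ℂ) (g (n - Pi.single i 1)) := fun hf hg i =>
    ⟨summable_mul_conj hf (hshift (Equiv.addRight (Pi.single i 1)) hg),
      summable_mul_conj hf (hshift (Equiv.subRight (Pi.single i 1)) hg)⟩
  have hq : ∀ i : Fin d, (Summable fun n => f (n + Pi.single i 1) * (starRingEnd ℂ) (g n)) ∧
      Summable fun n => f (n - Pi.single i 1) * (starRingEnd ℂ) (g n) := fun i =>
    ⟨summable_mul_conj (hshift (Equiv.addRight (Pi.single i 1)) hf) hg,
      summable_mul_conj (hshift (Equiv.subRight (Pi.single i 1)) hf) hg⟩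
  simp only [lap, map_sum, map_add, Finset.mul_sum, Finset.sum_mul, mul_add, add_mul]
  rw [Summable.tsum_finsetSum fun i _ => (hp hf hg i).1.add (hp hf hg i).2,
    Summable.tsum_finsetSum fun i _ => (hq i).1.add (hq i).2]
  refine Finset.sum_congr rfl fun i _ => ?_
  rw [(hp hf hg i).1.tsum_add (hp hf hg i).2, (hq i).1.tsum_add (hq i).2, add_comm]
  congr 1
  · have h := (Equiv.addRight (Pi.single i (1 : ℤ))).tsum_eq
      fun n => f n * (starRingEnd ℂ) (g (n - Pi.single i 1))
    rw [← h]
    simp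
  · have h := (Equiv.subRight (Pi.single i (1 : ℤ))).tsum_eq
      fun n => f n * (starRingEnd ℂ) (g (n + Pi.single i 1))
    rw [← h]
    simp

theorem inner_schrodinger (V : (Fin d → ℤ) → OnePoint ℝ) (x y : (schrodinger V).domain) :
    inner ℂ (schrodinger V x) (y : FiniteL2 V) = inner ℂ (x : FiniteL2 V) (schrodinger V y) := by
  let A : FiniteL2 V → FiniteL2 V := fun u =>
    ⟨fun n : ↥((infiniteSites V)ᶜ) => lap (extendZero V u) n, memℓp_lap V u⟩
  let M : (schrodinger V).domain → FiniteL2 V := fun u =>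
    ⟨fun n : ↥((infiniteSites V)ᶜ) => (realValue (V n) : ℂ) * (u : FiniteL2 V) n, u.2⟩
  have hAM : ∀ u, schrodinger V u = A u + M u := fun u => rfl
  rw [hAM, hAM, inner_add_left, inner_add_right]
  congr 1
  · rw [lp.inner_eq_tsum, lp.inner_eq_tsum]
    simp only [RCLike.inner_apply, A]
    have h1 := tsum_mul_extendZero V (y : FiniteL2 V)
      fun n => (starRingEnd ℂ) (lap (extendZero V (x : FiniteL2 V)) n)
    rw [h1, tsum_mul_conj_lap (summable_norm_sq_extendZero V y) (summable_norm_sq_extendZero V x)]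
    have hconj : ∀ n, (starRingEnd ℂ) (extendZero V (x : FiniteL2 V) n)
        = extendZero V (fun k => (starRingEnd ℂ) ((x : FiniteL2 V) k)) n := by
      intro n
      unfold extendZero
      split_ifs <;> simp
    simp only [hconj, mul_comm (lap _ _)]
    exact (tsum_mul_extendZero V _ fun n => lap (extendZero V (y : FiniteL2 V)) n).symm
  · rw [lp.inner_eq_tsum, lp.inner_eq_tsum]
    refine tsum_congr fun n => ?_
    simp only [RCLike.inner_apply, M, map_mul, Complex.conj_ofReal]
    ring

theorem isSelfAdjoint_resolvent {V : (Fin d → ℤ) → OnePoint ℝ} {E : ℝ}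
    {R : FiniteL2 V →L[ℂ] FiniteL2 V}
    (hR : ∀ y : FiniteL2 V, ∃ x : (schrodinger V).domain, (x : FiniteL2 V) = R y ∧
      schrodinger V x - (E : ℂ) • (x : FiniteL2 V) = y) : IsSelfAdjoint R := by
  rw [ContinuousLinearMap.isSelfAdjoint_iff_isSymmetric]
  intro y y'
  obtain ⟨x, hx, hxy⟩ := hR y
  obtain ⟨x', hx', hxy'⟩ := hR y'
  simp only [ContinuousLinearMap.coe_coe]
  rw [← hx, ← hx']
  conv_lhs => rw [← hxy']
  conv_rhs => rw [← hxy]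
  rw [inner_sub_left, inner_sub_right, inner_schrodinger, inner_smul_left, inner_smul_right,
    Complex.conj_ofReal]

/-- A nonzero spectral value `μ` of the resolvent at `t` comes from the point `t + 1 / μ` of the
spectrum of the operator. -/
theorem mem_realSpectrum_of_mem_spectrum_resolvent {V : (Fin d → ℤ) → OnePoint ℝ} {t μ : ℝ}
    (hμ : μ ≠ 0) {R : FiniteL2 V →L[ℂ] FiniteL2 V}
    (hR1 : ∀ y : FiniteL2 V, ∃ x : (schrodinger V).domain, (x : FiniteL2 V) = R y ∧
      schrodinger V x - (t : ℂ) • (x : FiniteL2 V) = y)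
    (hR2 : ∀ x : (schrodinger V).domain,
      R (schrodinger V x - (t : ℂ) • (x : FiniteL2 V)) = x)
    (hs : (μ : ℂ) ∈ spectrum ℂ R) : t + 1 / μ ∈ realSpectrum V := by
  by_contra hE
  obtain ⟨S, hS1, hS2⟩ : ((t + 1 / μ : ℝ) : ℂ) ∈ resolventSet (schrodinger V) := not_not.1 hE
  have hμ' : (μ : ℂ) ≠ 0 := by exact_mod_cast hμ
  push_cast at hS1 hS2
  apply hs
  let X : FiniteL2 V →L[ℂ] FiniteL2 V := (μ : ℂ)⁻¹ • (1 + (μ : ℂ)⁻¹ • S)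
  refine ⟨⟨algebraMap ℂ _ (μ : ℂ) - R, X, ?_, ?_⟩, rfl⟩
  · refine ContinuousLinearMap.ext fun y => ?_
    obtain ⟨x, hx, hxy⟩ := hS1 y
    have h1 : R (y + (μ : ℂ)⁻¹ • (x : FiniteL2 V)) = x := by
      rw [← hR2 x, ← hxy]
      congr 1
      rw [hR2, add_smul, one_div]
      abel
    simp only [X, mul_apply_eq_comp, smul_apply,
      add_apply, one_apply_eq_self, Algebra.algebraMap_eq_smul_one,
      sub_apply, ← hx, map_smul, h1]
    rw [smul_add, smul_smul (μ : ℂ) (μ : ℂ)⁻¹, mul_inv_cancel₀ hμ', one_smul, add_sub_cancel_right,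
      smul_smul, inv_mul_cancel₀ hμ', one_smul]
  · refine ContinuousLinearMap.ext fun y => ?_
    obtain ⟨x, hx, hxy⟩ := hR1 y
    have h1 : S ((μ : ℂ) • y - (x : FiniteL2 V)) = (μ : ℂ) • (x : FiniteL2 V) := by
      conv_rhs => rw [← hS2 x, ← map_smul]
      congr 1
      rw [← hxy, add_smul, smul_sub, smul_sub, smul_add, one_div, smul_smul (μ : ℂ) (μ : ℂ)⁻¹,
        mul_inv_cancel₀ hμ', one_smul]
      abel
    simp only [X, mul_apply_eq_comp, smul_apply,
      add_apply, one_apply_eq_self, Algebra.algebraMap_eq_smul_one,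
      sub_apply, ← hx, h1]
    rw [smul_smul (μ : ℂ)⁻¹ (μ : ℂ), inv_mul_cancel₀ hμ', one_smul, sub_add_cancel, smul_smul,
      inv_mul_cancel₀ hμ', one_smul]

/-- Every finite value of the potential is at distance at most `2d` from the spectrum. -/
theorem exists_mem_realSpectrum_near {V : (Fin d → ℤ) → OnePoint ℝ} {m : Fin d → ℤ} {t : ℝ}
    (hm : V m = (t : OnePoint ℝ)) : ∃ E ∈ realSpectrum V, |E - t| ≤ 2 * d := by
  by_cases ht : t ∈ realSpectrum V
  · exact ⟨t, ht, by simp⟩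
  obtain ⟨R, hR1, hR2⟩ : (t : ℂ) ∈ resolventSet (schrodinger V) := not_not.1 ht
  have hmV : m ∈ (infiniteSites V)ᶜ := fun h => OnePoint.coe_ne_infty t (hm.symm.trans h)
  let δ : (Fin d → ℤ) → ℂ := fun n => if n ∈ ({m} : Finset (Fin d → ℤ)) then 1 else 0
  have hδs : δ.support.Finite := (finite_singleton m).subset fun n hn => by
    by_contra h
    exact hn (by simp [δ, show n ≠ m from h])
  have hδ0 : ∀ n, V n = OnePoint.infty → δ n = 0 := fun n hn => by
    have : n ≠ m := fun h => hmV (h ▸ hn)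
    simp [δ, this]
  have hδQ : sqNorm δ = 1 := by
    have := sqNorm_ite_mem {m} fun _ => (1 : ℂ)
    simpa [δ] using this
  have hfin : (Function.support fun n : ↥((infiniteSites V)ᶜ) => δ n).Finite :=
    hδs.preimage Subtype.val_injective.injOn
  let x : FiniteL2 V := ⟨fun n => δ n, memℓp_of_finite_support hfin⟩
  have hx : x ∈ schrodingerDomain V := by
    refine memℓp_of_finite_support (hfin.subset fun n hn h => hn ?_)
    change (realValue (V n) : ℂ) * δ n = 0
    rw [show δ n = 0 from h, mul_zero]
  have hx1 : ‖x‖ = 1 := by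
    have h1 : ENNReal.ofReal (‖x‖ ^ 2) = 1 := by
      rw [ofReal_norm_sq_eq_tsum, ← hδQ]
      refine tsum_subtype_eq_of_support_subset
        (f := fun n => ENNReal.ofReal (‖δ n‖ ^ 2)) (s := (infiniteSites V)ᶜ) fun n hn h => hn ?_
      simp [hδ0 n h]
    rw [ENNReal.ofReal_eq_one] at h1
    nlinarith [norm_nonneg x]
  let z : FiniteL2 V := schrodinger V ⟨x, hx⟩ - (t : ℂ) • x
  have hz : ‖z‖ ≤ 2 * d := by
    have happ : ∀ n : ↥((infiniteSites V)ᶜ), z n = lap δ n := by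
      intro n
      have h1 : z n = lap (extendZero V fun n => δ n) n + (realValue (V n) : ℂ) * δ n - t * δ n :=
        rfl
      rw [h1, extendZero_comp_val V hδ0]
      by_cases hn : (n : Fin d → ℤ) = m
      · rw [hn, hm]
        change lap δ m + (t : ℂ) * δ m - t * δ m = lap δ m
        ring
      · simp [δ, hn]
    have h1 : ENNReal.ofReal (‖z‖ ^ 2) ≤ ENNReal.ofReal ((2 * d) ^ 2) := by
      calc ENNReal.ofReal (‖z‖ ^ 2) ≤ sqNorm (lap δ) := by
            rw [ofReal_norm_sq_eq_tsum]
            simp only [happ]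
            exact ENNReal.tsum_comp_le_tsum_of_injective Subtype.val_injective
              fun n => ENNReal.ofReal (‖lap δ n‖ ^ 2)
        _ ≤ 4 * d ^ 2 * 1 := hδQ ▸ sqNorm_lap_le δ
        _ = ENNReal.ofReal ((2 * d) ^ 2) := by
            rw [mul_pow, ENNReal.ofReal_mul (by norm_num), ENNReal.ofReal_pow (by positivity)]
            norm_num
    rw [ENNReal.ofReal_le_ofReal_iff (by positivity)] at h1
    exact abs_le_of_sq_le_sq' h1 (by positivity) |>.2
  have hRz : 1 ≤ ‖R‖ * (2 * d) := by
    calc 1 = ‖x‖ := hx1.symm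
      _ = ‖R z‖ := by rw [show R z = x from hR2 ⟨x, hx⟩]
      _ ≤ ‖R‖ * ‖z‖ := R.le_opNorm _
      _ ≤ ‖R‖ * (2 * d) := by gcongr
  have : Nontrivial (FiniteL2 V) := ⟨x, 0, fun h => by simp [h] at hx1⟩
  have hsa := isSelfAdjoint_resolvent hR1
  obtain ⟨μ, hμs, hμ⟩ := spectrum.exists_nnnorm_eq_spectralRadius R
  rw [hsa.spectralRadius_eq_nnnorm, ENNReal.coe_inj] at hμ
  have hμn : ‖μ‖ = ‖R‖ := congrArg NNReal.toReal hμ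
  have hμre : μ = (μ.re : ℂ) := hsa.mem_spectrum_eq_re hμs
  have hμabs : |μ.re| = ‖R‖ := by
    rw [← hμn, hμre, Complex.norm_real, Complex.ofReal_re, Real.norm_eq_abs]
  have hRpos : 0 < ‖R‖ := by
    by_contra h
    have : ‖R‖ = 0 := le_antisymm (not_lt.1 h) (norm_nonneg _)
    rw [this] at hRz
    linarith
  have hμ0 : μ.re ≠ 0 := by
    rw [← abs_pos, hμabs]
    exact hRpos
  rw [hμre] at hμs
  refine ⟨t + 1 / μ.re, mem_realSpectrum_of_mem_spectrum_resolvent hμ0 hR1 hR2 hμs, ?_⟩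
  rw [add_sub_cancel_left, abs_div, abs_one, hμabs, div_le_iff₀ hRpos]
  linarith

/-! ### The generalized spectrum -/

theorem coe_mem_genSpectrum {V : (Fin d → ℤ) → OnePoint ℝ} {E : ℝ} (hE : E ∈ realSpectrum V) :
    (E : OnePoint ℝ) ∈ genSpectrum V := by
  unfold genSpectrum
  split_ifs
  · exact subset_closure ⟨E, hE, rfl⟩
  · exact Or.inl ⟨E, hE, rfl⟩

/-- If the potential takes values arbitrarily close to `∞`, then `∞` is in the generalized
spectrum. -/
theorem infty_mem_genSpectrum {V : (Fin d → ℤ) → OnePoint ℝ}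
    (hV : ∀ U ∈ 𝓝 (OnePoint.infty : OnePoint ℝ), ∃ n, V n ∈ U) :
    OnePoint.infty ∈ genSpectrum V := by
  unfold genSpectrum
  split_ifs with hI
  · rw [mem_closure_iff_nhds]
    intro U hU
    -- a neighbourhood of `∞` contains all reals of large modulus
    have h1 : ∀ᶠ r : ℝ in cocompact ℝ, (r : OnePoint ℝ) ∈ U := by
      rw [← coclosedCompact_eq_cocompact]
      exact OnePoint.tendsto_coe_infty hU
    rw [← Metric.cobounded_eq_cocompact] at h1
    obtain ⟨B, -, hB⟩ := (Filter.hasBasis_cobounded_norm (E := ℝ)).eventually_iff.1 h1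
    have hW : (((↑) : ℝ → OnePoint ℝ) '' Icc (-(B + 2 * d)) (B + 2 * d))ᶜ
        ∈ 𝓝 (OnePoint.infty : OnePoint ℝ) := by
      refine ((isCompact_Icc.image OnePoint.continuous_coe).isClosed.isOpen_compl).mem_nhds ?_
      simp
    obtain ⟨n, hn⟩ := hV _ hW
    have hfin : V n ≠ OnePoint.infty := fun h => by
      have : n ∈ infiniteSites V := h
      rw [hI] at this
      exact this
    obtain ⟨t, ht⟩ := OnePoint.ne_infty_iff_exists.1 hfin
    obtain ⟨E, hE, hEt⟩ := exists_mem_realSpectrum_near ht.symm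
    refine ⟨E, hB ?_, E, hE, rfl⟩
    by_contra hlt
    simp only [mem_ofPred_eq, not_le, Real.norm_eq_abs] at hlt
    refine hn ⟨t, ?_, ht⟩
    have h2 := abs_lt.1 hlt
    have h3 := abs_le.1 hEt
    constructor <;> linarith [h2.1, h2.2, h3.1, h3.2]
  · exact Or.inr rfl

end GapFilling

end

open GapFilling

theorem theorem4p2 {d : ℕ} (α : Fin d → ℝ) (hα : ∃ i, Irrational (α i))
    (f : ℝ → EReal) (hf : GapFilling.HasSimpleDiscontinuity f)
    (𝒜 : Set (OnePoint ℝ)) (φ : ℝ → OnePoint ℝ)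
    (hφ : GapFilling.IsArcParam φ 𝒜 (GapFilling.toRbar (Function.leftLim f 1))
      (GapFilling.toRbar (f 0)))
    (hdeg : ¬ (GapFilling.gluedCircleMap hf hφ).Nullhomotopic) :
    ⋃ t ∈ 𝒜, GapFilling.genSpectrum
      (GapFilling.qpPotential (GapFilling.replaceAtZero f t) α 0) = Set.univ := by
  obtain ⟨Θ, D, hΘ, hD, hΘG, hper⟩ := exists_angle_lift_circle _ hdeg
  have hglued : ∀ y ∈ Ico (-1 : ℝ) 1, cotOnePoint (Θ y) = glued f φ y := fun y hy => by
    rw [hΘG]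
    exact AddCircle.liftIco_coe_apply (p := (2 : ℝ)) (a := -1) (f := glued f φ)
      ⟨hy.1, hy.2.trans_eq (by norm_num)⟩
  have hleft : ∀ s ∈ Icc (-1 : ℝ) 0, cotOnePoint (Θ s) = φ s := by
    intro s hs
    rw [hglued s ⟨hs.1, by linarith [hs.2]⟩]
    rcases hs.2.lt_or_eq with h | h
    · simp [glued, not_le.2 h]
    · simp [glued, h, hφ.right_eq]
  have hone : cotOnePoint (Θ 1) = φ (-1) := by
    rw [← hleft (-1) (by simp), hΘG, hΘG]
    congr 1
    have := AddCircle.coe_add_period (2 : ℝ) (-1)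
    rw [← this]
    norm_num
  have hmemA : ∀ s, (s ∈ Icc (-1 : ℝ) 0 ∨ s = 1) → cotOnePoint (Θ s) ∈ 𝒜 := by
    rintro s (hs | rfl)
    · rw [hleft s hs, ← hφ.image_eq]
      exact ⟨s, hs, rfl⟩
    · rw [hone, ← hφ.image_eq]
      exact ⟨-1, by simp, rfl⟩
  have hright : ∀ y : ℝ, cotOnePoint (Θ (Int.fract y)) = toRbar (f y) := by
    intro y
    have h0 := Int.fract_nonneg y
    rw [hglued _ ⟨by linarith, Int.fract_lt_one y⟩, glued, if_pos h0]
    congr 1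
    have := hf.periodic.int_mul ⌊y⌋ (Int.fract y)
    rw [mul_one, Int.fract_add_floor] at this
    exact this.symm
  have hpot : ∀ s n, cotOnePoint (hullAngle Θ s (phase α n))
      = qpPotential (replaceAtZero f (cotOnePoint (Θ s))) α 0 n := by
    intro s n
    have h1 : qpPotential (replaceAtZero f (cotOnePoint (Θ s))) α 0 n
        = replaceAtZero f (cotOnePoint (Θ s)) (phase α n) := by
      rw [qpPotential, zero_add, phase]
    rw [h1, replaceAtZero, hullAngle]
    split_ifs
    · rfl
    · rw [hright]
  rw [eq_univ_iff_forall]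
  intro v
  simp only [mem_iUnion, exists_prop]
  induction v using OnePoint.rec with
  | coe E =>
    obtain ⟨y, s, ψ, hs, hb, h0, hψ⟩ := exists_bounded_solution α hΘ hD hper E
    refine ⟨cotOnePoint (Θ s), hmemA s hs, coe_mem_genSpectrum ?_⟩
    exact mem_realSpectrum_of_local_limit hb h0 hψ (hpot s)
      fun S δ hδ => exists_translate_near hα hΘ s y S hδ
  | infty =>
    -- The angle increases by a nonzero multiple of `π` on `[-1, 1]`, so it passes a zero of `sin`.
    obtain ⟨y, hy, hy0⟩ : ∃ y ∈ Icc (-1 : ℝ) 1, cotOnePoint (Θ y) = OnePoint.infty := by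
      have hjump : Θ 1 = Θ (-1) + D * Real.pi := by
        have := hper (-1)
        norm_num at this
        exact this
      obtain ⟨k, hk⟩ : ∃ k : ℤ, k * Real.pi ∈ uIcc (Θ (-1)) (Θ 1) := by
        have hpi := Real.pi_pos
        have h1 := Int.floor_le (Θ (-1) / Real.pi)
        have h2 := Int.lt_floor_add_one (Θ (-1) / Real.pi)
        rw [le_div_iff₀ hpi] at h1
        rw [div_lt_iff₀ hpi] at h2
        rcases lt_or_gt_of_ne hD with hneg | hpos
        · refine ⟨⌊Θ (-1) / Real.pi⌋, mem_uIcc.2 (Or.inr ⟨?_, h1⟩)⟩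
          have : (D : ℝ) ≤ -1 := by exact_mod_cast (by omega : D ≤ -1)
          nlinarith
        · refine ⟨⌊Θ (-1) / Real.pi⌋ + 1, mem_uIcc.2 (Or.inl ⟨?_, ?_⟩)⟩
          · push_cast
            exact h2.le
          · have : (1 : ℝ) ≤ D := by exact_mod_cast hpos
            push_cast
            nlinarith
      obtain ⟨y, hy, hyk⟩ := intermediate_value_uIcc hΘ.continuousOn hk
      rw [uIcc_of_le (by norm_num)] at hy
      exact ⟨y, hy, by simp [cotOnePoint, hyk, Real.sin_int_mul_pi]⟩
    by_cases hyA : y ∈ Icc (-1 : ℝ) 0 ∨ y = 1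
    · refine ⟨OnePoint.infty, hy0 ▸ hmemA y hyA, infty_mem_genSpectrum fun U hU => ⟨0, ?_⟩⟩
      simpa [qpPotential, replaceAtZero] using mem_of_mem_nhds hU
    · rw [not_or, mem_Icc, not_and, not_le] at hyA
      have hy1 : y < 1 := lt_of_le_of_ne hy.2 hyA.2
      have hy2 : 0 < y := hyA.1 hy.1
      have hfr : Int.fract y = y := Int.fract_eq_self.2 ⟨hy2.le, hy1⟩
      refine ⟨cotOnePoint (Θ 0), hmemA 0 (Or.inl (by simp)), infty_mem_genSpectrum fun U hU => ?_⟩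
      have hcont : ContinuousAt (fun x => cotOnePoint (hullAngle Θ 0 x)) y :=
        continuous_cotOnePoint.continuousAt.comp
          (continuousAt_hullAngle hΘ 0 (by rw [hfr]; exact hy2.ne'))
      have hval : cotOnePoint (hullAngle Θ 0 y) = OnePoint.infty := by
        rw [hullAngle, if_neg (by rw [hfr]; exact hy2.ne'), hfr, hy0]
      have hpre : (fun x => cotOnePoint (hullAngle Θ 0 x)) ⁻¹' U ∈ 𝓝 y :=
        hcont (by beta_reduce; rw [hval]; exact hU)
      obtain ⟨m, j, hm⟩ := exists_phase_mem hα hpre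
      refine ⟨m, ?_⟩
      rw [← hpot, ← hullAngle_add_intCast Θ 0 _ j]
      exact hm
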